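/- **Setting.** Let $d,T\ge 1$ be integers. Rewards follow a canonical exponential family: for a reference measure $\nu$ on $\mathbb R$, a measurable $c:\mathbb R\to\mathbb R$ and a $C^2$ function $b:\mathbb R\to\mathbb R$, $d\mathbb P_\theta(r\mid a)=\exp\big(r\,a^\top\theta-b(a^\top\theta)+c(r)\big)\,d\nu(r)$ is a probability measure for every value of $a^\top\theta\in\mathbb R$. Put $\mu=b'$. In round $t=1,\dots,T$ an action set $\mathcal A_t\subset\mathbb R^d$ is revealed, the agent plays $a_t\in\mathcal A_t$ and then receives $r_{t+1}$. There is a filtration $(\mathcal F_t)$ such that $a_t$ is $\mathcal F_t$-measurable, $r_{t+1}$ is $\mathcal F_{t+1}$-measurable, and the conditional law of $r_{t+1}$ given $\mathcal F_t$ is $\mathbb P_{\theta^\star_t}(\cdot\mid a_t)$, where $\theta^\star_1,\dots,\theta^\star_T\in\mathbb R^d$ is a deterministic sequence with at most $\Gamma_T$ indices $2\le t\le T$ such that $\theta^\star_t\ne\theta^\star_{t-1}$. The dynamic regret is $R_T=\sum_{t=1}^T\big(\sup_{a\in\mathcal A_t}\mu(a^\top\theta^\star_t)-\mu(a_t^\top\theta^\star_t)\big)$.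 **Assumptions.** $\|\theta^\star_t\|_2\le S$; $\|a\|_2\le 1$ for all $a\in\mathcal A_t$; $0\le r_{t+1}\le m$ for $1\le t\le T$, with $m>0$; $\mu$ is $C^1$, $k_\mu$-Lipschitz, and $c_\mu=\inf_{\|\theta\|_2\le S,\|a\|_2\le 1}\mu'(a^\top\theta)>0$; $\mu$ is twice differentiable with $|\mu''|\le\mu'$. **Algorithm SW-GLUCB** with parameters $\lambda>0$, $\delta\in(0,1]$ and integer window $\tau\ge 1$. With $s$ ranging over $\max(1,t-\tau)\le s\le t-1$, let $\hat\theta_t$ be the maximizer over $\mathbb R^d$ of $\sum_s\log\big(\exp(r_{s+1}a_s^\top\theta-b(a_s^\top\theta)+c(r_{s+1}))\big)-\frac\lambda2\|\theta\|_2^2$ and $V_t=\sum_s a_sa_s^\top+\frac{\lambda}{c_\mu}I_d$. Play $a_t\in\arg\max_{a\in\mathcal A_t}\ \mu(a^\top\hat\theta_t)+\frac{\beta_t^\delta}{\sqrt{c_\mu}}\|a\|_{V_t^{-1}}$ (any tie-breaking), where $$\rho_t^\delta=\tfrac{\sqrt\lambda}{2m}+\tfrac{2m}{\sqrt\lambda}\log\tfrac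 T\delta+\tfrac{dm}{\sqrt\lambda}\log\Big(1+\tfrac{k_\mu\min(t,\tau)}{d\lambda}\Big)+\tfrac{2m}{\sqrt\lambda}d\log 2,$$ $$\beta_t^\delta=k_\mu\sqrt\lambda\Big(1+S+\sqrt{\tfrac{1+S}{\lambda}}\,\rho_t^\delta+\big(\tfrac{\rho_t^\delta}{\sqrt\lambda}\big)^2\Big)^{3/2}.$$ **Theorem.** (1) With probability at least $1-\delta$, $$R_T\le m\,\Gamma_T\tau+\frac{2\beta_T^\delta}{\sqrt{c_\mu}}\sqrt{dT}\sqrt{\lceil T/\tau\rceil}\sqrt{2\max\big(1,\tfrac{c_\mu}{\lambda}\big)}\sqrt{\log\Big(1+\frac{c_\mu\tau}{d\lambda}\Big)}.$$ In particular, if $m\le 1$ then, with probability at least $1-\delta$, $$R_T\le \Gamma_T\tau+\frac{2\beta_T^\delta}{\sqrt{c_\mu}}\sqrt{dT}\sqrt{\lceil T/\tau\rceil}\sqrt{2\max\big(1,\tfrac1\lambda\big)}\sqrt{\log\Big(1+\frac{\tau}{d\lambda}\Big)}.$$ (2) There is a universal integer $p\ge 0$ and, for all $S,m,k_\mu$,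 a constant $C$ depending only on $(S,m,k_\mu)$ such that the following holds for every instance as above with $T\ge 2$, $\Gamma_T\ge 1$ and $\lambda=d\log T$. If $\tau\ge1$ is an integer with $\big|\tau-\big(\tfrac{dT}{c_\mu^{1/2}\Gamma_T}\big)^{2/3}\big|\le 1$, then with probability at least $1-\delta$ $$R_T\le C\,\log(T/\delta)^p\;c_\mu^{-1/3}d^{2/3}\Gamma_T^{1/3}T^{2/3}.$$ If $\tau\ge1$ is an integer with $\big|\tau-\big(\tfrac{dT}{c_\mu^{1/2}}\big)^{2/3}\big|\le 1$ (a choice that does not use $\Gamma_T$), then with probability at least $1-\delta$ $$R_T\le C\,\log(T/\delta)^p\;c_\mu^{-1/3}d^{2/3}\,\Gamma_T\,T^{2/3}.$$ -/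

import Mathlib

open MeasureTheory ProbabilityTheory

noncomputable section

namespace GLB

/-- The space of actions and parameters: `ℝ^d` with the Euclidean norm. -/
abbrev Vec (d : ℕ) : Type := EuclideanSpace ℝ (Fin d)

/-- A canonical one-parameter exponential family with respect to a reference measure `ν`:
for every natural parameter `η`, the density `r ↦ exp (r η - b η + c r)` with respect to `ν`
is a probability density, and `b` is twice continuously differentiable. -/
structure ExpFamily where
  ν : Measure ℝ
  b : ℝ → ℝ
  c : ℝ → ℝ
  measurable_c : Measurable c
  contDiff_b : ContDiff ℝ 2 b
  lintegral_density : ∀ η : ℝ, ∫⁻ r, ENNReal.ofReal (Real.exp (r * η - b η + c r)) ∂ν = 1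

namespace ExpFamily

variable (F : ExpFamily)

/-- The log-density at reward `r` for the natural parameter `η` (`η = aᵀθ` in the bandit). -/
def logDensity (η r : ℝ) : ℝ := r * η - F.b η + F.c r

/-- The distribution of the reward for the natural parameter `η`. -/
def law (η : ℝ) : Measure ℝ :=
  F.ν.withDensity fun r => ENNReal.ofReal (Real.exp (F.logDensity η r))

/-- The mean function (inverse link) `μ = b'`. -/
def mean : ℝ → ℝ := deriv F.b

/-- `c_μ = inf { μ'(aᵀθ) : ‖θ‖ ≤ S, ‖a‖ ≤ 1 }`. -/
def cmu (d : ℕ) (S : ℝ) : ℝ :=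
  sInf {x : ℝ | ∃ θ a : Vec d, ‖θ‖ ≤ S ∧ ‖a‖ ≤ 1 ∧ x = deriv F.mean (inner ℝ a θ)}

/-- The assumptions on the mean function: it is continuously differentiable, `kμ`-Lipschitz,
`c_μ > 0`, and it is (generalized) self-concordant: `μ` is twice differentiable and
`|μ''| ≤ μ'`. -/
structure LinkAssumptions (d : ℕ) (S kμ : ℝ) : Prop where
  contDiff_mean : ContDiff ℝ 1 F.mean
  lipschitz : ∀ x y : ℝ, |F.mean x - F.mean y| ≤ kμ * |x - y|
  cmu_pos : 0 < F.cmu d S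
  differentiable_deriv : Differentiable ℝ (deriv F.mean)
  self_concordant : ∀ x : ℝ, |deriv (deriv F.mean) x| ≤ deriv F.mean x

end ExpFamily

variable {d : ℕ} {Ω : Type*} [MeasurableSpace Ω]

/-- The generalized linear bandit over the rounds `t = 1, …, T`: deterministic parameters `θ t`,
action sets `A t`, played actions `a t`, and rewards `r (t + 1)` received after playing `a t`.
`ℱ t` is the information available when `a t` has been chosen and `r (t + 1)` is still unknown. -/
structure IsBandit (F : ExpFamily) (P : Measure Ω) (ℱ : Filtration ℕ ‹MeasurableSpace Ω›)
    (T : ℕ) (S m : ℝ) (θ : ℕ → Vec d) (A : ℕ → Ω → Set (Vec d)) (a : ℕ → Ω → Vec d)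
    (r : ℕ → Ω → ℝ) : Prop where
  norm_param_le : ∀ t ∈ Finset.Icc 1 T, ‖θ t‖ ≤ S
  norm_action_le : ∀ᵐ ω ∂P, ∀ t ∈ Finset.Icc 1 T, ∀ x ∈ A t ω, ‖x‖ ≤ 1
  action_mem : ∀ᵐ ω ∂P, ∀ t ∈ Finset.Icc 1 T, a t ω ∈ A t ω
  action_measurable : ∀ t ∈ Finset.Icc 1 T, StronglyMeasurable[ℱ t] (a t)
  reward_measurable : ∀ t ∈ Finset.Icc 1 T, StronglyMeasurable[ℱ (t + 1)] (r (t + 1))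
  /-- Given the past and `a t`, the reward has the law of the family at `(a t)ᵀ(θ t)`. -/
  reward_law : ∀ t ∈ Finset.Icc 1 T, ∀ B : Set ℝ, MeasurableSet B →
    P[Set.indicator (r (t + 1) ⁻¹' B) (fun _ => (1 : ℝ)) | ℱ t]
      =ᵐ[P] fun ω => (F.law (inner ℝ (a t ω) (θ t))).real B
  reward_bounded : ∀ᵐ ω ∂P, ∀ t ∈ Finset.Icc 1 T, 0 ≤ r (t + 1) ω ∧ r (t + 1) ω ≤ m

/-- The number of rounds `2 ≤ t ≤ T` at which the parameter changes. -/
def numChanges (T : ℕ) (θ : ℕ → Vec d) : ℕ :=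
  Set.ncard {t : ℕ | 2 ≤ t ∧ t ≤ T ∧ θ t ≠ θ (t - 1)}

/-- The dynamic regret `R_T`. -/
def regret (F : ExpFamily) (T : ℕ) (θ : ℕ → Vec d) (A : ℕ → Ω → Set (Vec d))
    (a : ℕ → Ω → Vec d) (ω : Ω) : ℝ :=
  ∑ t ∈ Finset.Icc 1 T,
    (sSup ((fun x : Vec d => F.mean (inner ℝ x (θ t))) '' A t ω)
      - F.mean (inner ℝ (a t ω) (θ t)))

/-- The rounds `max(1, t - τ), …, t - 1` in the sliding window at time `t`
(`t - τ` is truncated at `0`). -/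
def window (τ t : ℕ) : Finset ℕ := Finset.Ico (max 1 (t - τ)) t

/-- The penalized truncated log-likelihood
`∑_{s = max(1, t-τ)}^{t-1} log P_θ(r_{s+1} | a_s) - (λ/2) ‖θ‖²`. -/
def penLogLik (F : ExpFamily) (lam : ℝ) (τ t : ℕ) (a : ℕ → Vec d) (r : ℕ → ℝ)
    (θ : Vec d) : ℝ :=
  ∑ s ∈ window τ t, F.logDensity (inner ℝ (a s) θ) (r (s + 1)) - lam / 2 * ‖θ‖ ^ 2

/-- The design matrix `V_t = ∑_{s = max(1, t-τ)}^{t-1} a_s a_sᵀ + (λ / c_μ) I`. -/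
def designMatrix (lam cμ : ℝ) (τ t : ℕ) (a : ℕ → Vec d) : Matrix (Fin d) (Fin d) ℝ :=
  ∑ s ∈ window τ t, Matrix.vecMulVec (a s).ofLp (a s).ofLp
    + (lam / cμ) • (1 : Matrix (Fin d) (Fin d) ℝ)

/-- `‖x‖_M = √(xᵀ M x)`. -/
def matNorm (M : Matrix (Fin d) (Fin d) ℝ) (x : Vec d) : ℝ :=
  Real.sqrt (x.ofLp ⬝ᵥ Matrix.mulVec M x.ofLp)

/-- The radius `ρ_t^δ`. -/
def rho (d T τ : ℕ) (lam m kμ δ : ℝ) (t : ℕ) : ℝ :=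
  Real.sqrt lam / (2 * m) + 2 * m / Real.sqrt lam * Real.log (T / δ)
    + d * m / Real.sqrt lam * Real.log (1 + kμ * (min t τ : ℕ) / (d * lam))
    + 2 * m / Real.sqrt lam * d * Real.log 2

/-- The exploration coefficient `β_t^δ`. -/
def beta (d T τ : ℕ) (lam S m kμ δ : ℝ) (t : ℕ) : ℝ :=
  kμ * Real.sqrt lam *
    (1 + S + Real.sqrt ((1 + S) / lam) * rho d T τ lam m kμ δ t
      + (rho d T τ lam m kμ δ t / Real.sqrt lam) ^ 2) ^ (3 / 2 : ℝ)

/-- The upper confidence bound `μ(xᵀ θhat) + β_t^δ / √c_μ ‖x‖_{V_t⁻¹}` of the action `x`. -/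
def ucb (F : ExpFamily) (T τ : ℕ) (lam S m kμ δ : ℝ) (t : ℕ) (a : ℕ → Vec d) (θhat : Vec d)
    (x : Vec d) : ℝ :=
  F.mean (inner ℝ x θhat)
    + beta d T τ lam S m kμ δ t / Real.sqrt (F.cmu d S)
      * matNorm (designMatrix lam (F.cmu d S) τ t a)⁻¹ x

/-- The actions `a t` are those of the sliding-window algorithm: in every round, `θhat t` is the
maximizer over all of `ℝ^d` of the penalized truncated log-likelihood, and `a t` maximizes the
upper confidence bound over the current action set (ties are broken arbitrarily). -/
structure IsSWGLUCB (F : ExpFamily) (P : Measure Ω) (T τ : ℕ) (lam S m kμ δ : ℝ)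
    (A : ℕ → Ω → Set (Vec d)) (a : ℕ → Ω → Vec d) (r : ℕ → Ω → ℝ) (θhat : ℕ → Ω → Vec d) :
    Prop where
  isMLE : ∀ᵐ ω ∂P, ∀ t ∈ Finset.Icc 1 T,
    IsMaxOn (penLogLik F lam τ t (fun s => a s ω) (fun s => r s ω)) Set.univ (θhat t ω)
  optimistic : ∀ᵐ ω ∂P, ∀ t ∈ Finset.Icc 1 T,
    IsMaxOn (ucb F T τ lam S m kμ δ t (fun s => a s ω) (θhat t ω)) (A t ω) (a t ω)

end GLB

end

namespace GLB

/-! ### Laws of the exponential family: cumulants, equivalence of the laws, consequences of bounded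
rewards. -/

namespace ExpFamily

variable (F : ExpFamily)

/-! The analysis is optimism in a sliding window, with a confidence set in the metric of the local
Fisher information.

Concentration. The cumulant generating function of a reward is an increment of `b`, and since
rewards lie in `[0, m]`, the centred one is at most `μ' w ^ 2` for `|w| ≤ 1 / m` (`exp_bound`).
Hence for each fixed `u` with `‖u‖ ≤ 1 / m` the exponential of the score minus its conditional
quadratic form, started at the left end of the window, has expectation at most one
(`lintegral_exp_score_le_one`). Averaging over `u` against a Gaussian truncated to this ball, then
Markov's inequality and a union bound over the `T` rounds, bounds the score in all directions by
`rho` times the norm of the regularized Fisher information (`sub_gramForm_le_of_mixture`,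
`measure_forall_scoreBound_ge`).

Estimation. In a round whose window contains no parameter change, the first-order condition
expresses the score through differences of means at `θhat` and at the true parameter.
Self-concordance bounds these below by the Fisher form at the true parameter, up to a factor `1 +
‖θhat - θ‖` (`selfConcordant_mul_sub_ge`). The error thus satisfies a self-bounding quadratic
inequality, whose solution is `beta` (`sqrt_gramForm_sub_le`); the estimator need not be projected
onto the ball of radius `S`. As the Fisher form dominates `c_μ V_t`, only `1 / √c_μ` enters the
bonus.

Regret. A change spoils at most `τ` rounds, each costing at most `m`; in the others optimism gives
twice the bonus. The bonuses are summed by Cauchy–Schwarz and the elliptical potential on blocks of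
length `τ` (`sum_sq_matNorm_le`).

Rates. With `λ = d log T` the leading term is at most a polylogarithm times `d T / √(c_μ τ)`. The
window `X` solving `d T / √c_μ = g X ^ (3 / 2)` makes this comparable to `g X`, while the change
term is of order `Γ X`; `g = Γ` and `g = 1` give the two rates. -/

lemma measurable_density (η : ℝ) :
    Measurable fun r => ENNReal.ofReal (Real.exp (F.logDensity η r)) := by
  have := F.measurable_c
  unfold logDensity
  fun_prop

instance isProbabilityMeasure_law (η : ℝ) : IsProbabilityMeasure (F.law η) := by
  constructor
  rw [law, withDensity_apply _ MeasurableSet.univ, Measure.restrict_univ]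
  exact F.lintegral_density η

lemma law_eq_withDensity (η₀ η : ℝ) :
    F.law η = (F.law η₀).withDensity
      fun r => ENNReal.ofReal (Real.exp (r * (η - η₀) - F.b η + F.b η₀)) := by
  rw [law, law, ← withDensity_mul _ (F.measurable_density η₀) (by fun_prop)]
  congr 1
  ext r
  rw [Pi.mul_apply, ← ENNReal.ofReal_mul (Real.exp_pos _).le, ← Real.exp_add]
  congr 2
  unfold logDensity
  ring

lemma law_absolutelyContinuous (η₀ η : ℝ) : F.law η ≪ F.law η₀ := by
  rw [F.law_eq_withDensity η₀ η]
  exact withDensity_absolutelyContinuous _ _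

lemma lintegral_exp_law (η w : ℝ) :
    ∫⁻ x, ENNReal.ofReal (Real.exp (w * x)) ∂F.law η
      = ENNReal.ofReal (Real.exp (F.b (η + w) - F.b η)) := by
  rw [law, lintegral_withDensity_eq_lintegral_mul _ (F.measurable_density η) (by fun_prop)]
  have h := F.lintegral_density (η + w)
  have : ∀ r, ((fun r => ENNReal.ofReal (Real.exp (F.logDensity η r))) *
      fun x => ENNReal.ofReal (Real.exp (w * x))) r =
      ENNReal.ofReal (Real.exp (F.b (η + w) - F.b η)) *
        ENNReal.ofReal (Real.exp (r * (η + w) - F.b (η + w) + F.c r)) := by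
    intro r
    rw [Pi.mul_apply, ← ENNReal.ofReal_mul (Real.exp_pos _).le, ← Real.exp_add,
      ← ENNReal.ofReal_mul (Real.exp_pos _).le, ← Real.exp_add]
    congr 2
    unfold logDensity
    ring
  simp_rw [this]
  rw [lintegral_const_mul' _ _ ENNReal.ofReal_ne_top, h, mul_one]

lemma integrable_exp_law (η w : ℝ) : Integrable (fun x => Real.exp (w * x)) (F.law η) := by
  refine ⟨by fun_prop, ?_⟩
  rw [hasFiniteIntegral_iff_ofReal (Filter.Eventually.of_forall fun x => (Real.exp_pos _).le),
    F.lintegral_exp_law]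
  exact ENNReal.ofReal_lt_top

lemma mgf_law (η w : ℝ) : mgf id (F.law η) w = Real.exp (F.b (η + w) - F.b η) := by
  rw [mgf]
  simp only [id]
  rw [integral_eq_lintegral_of_nonneg_ae (Filter.Eventually.of_forall fun x => (Real.exp_pos _).le)
    (F.integrable_exp_law η w).1, F.lintegral_exp_law, ENNReal.toReal_ofReal (Real.exp_pos _).le]

lemma cgf_law (η : ℝ) : cgf id (F.law η) = fun w => F.b (η + w) - F.b η := by
  ext w
  rw [cgf, mgf_law, Real.log_exp]

lemma zero_mem_interior_integrableExpSet (η : ℝ) :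
    (0 : ℝ) ∈ interior (integrableExpSet id (F.law η)) := by
  have : integrableExpSet id (F.law η) = Set.univ := by
    ext w
    simpa [integrableExpSet] using F.integrable_exp_law η w
  simp [this]

lemma deriv_cgf_law (η : ℝ) : deriv (cgf id (F.law η)) = fun w => F.mean (η + w) := by
  rw [cgf_law]
  ext w
  rw [deriv_sub_const, deriv_comp_const_add]
  rfl

lemma integral_law (η : ℝ) : ∫ x, x ∂F.law η = F.mean η := by
  have h := deriv_cgf_zero (F.zero_mem_interior_integrableExpSet η)
  rw [deriv_cgf_law] at h
  simpa using h.symm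

lemma variance_law (η : ℝ) : Var[id; F.law η] = deriv F.mean η := by
  have h0 := F.zero_mem_interior_integrableExpSet η
  have h := variance_tilted_mul h0
  have e : (F.law η).tilted (fun x => 0 * id x) = F.law η := by simp
  rw [e] at h
  rw [h, iteratedDeriv_succ, iteratedDeriv_one, deriv_cgf_law, deriv_comp_const_add, add_zero]

lemma law_integrable_id (η : ℝ) : Integrable (fun x => x) (F.law η) := by
  have := memLp_of_mem_interior_integrableExpSet (F.zero_mem_interior_integrableExpSet η) 1
  exact memLp_one_iff_integrable.1 (by rw [ENNReal.coe_one] at this; exact this)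

/-- All the laws of the family are supported in `[0, m]`. -/
def SupportedIn (m : ℝ) : Prop := ∀ η, ∀ᵐ x ∂F.law η, x ∈ Set.Icc 0 m

variable {F}

/-- All laws are mutually absolutely continuous, since their relative densities are exponentials. -/
lemma SupportedIn.of_law {m η₀ : ℝ} (h : ∀ᵐ x ∂F.law η₀, x ∈ Set.Icc 0 m) : F.SupportedIn m :=
  fun η => (F.law_absolutelyContinuous η₀ η) h

lemma SupportedIn.mean_mem {m : ℝ} (h : F.SupportedIn m) (η : ℝ) : F.mean η ∈ Set.Icc 0 m := by
  rw [← integral_law]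
  constructor
  · exact integral_nonneg_of_ae ((h η).mono fun x hx => hx.1)
  · calc ∫ x, x ∂F.law η ≤ ∫ x, m ∂F.law η :=
        integral_mono_ae (F.law_integrable_id η) (integrable_const _) ((h η).mono fun x hx => hx.2)
      _ = m := by simp

lemma SupportedIn.deriv_mean_le {m : ℝ} (h : F.SupportedIn m) (η : ℝ) :
    deriv F.mean η ≤ (m / 2) ^ 2 := by
  rw [← variance_law]
  simpa using variance_le_sq_of_bounded (X := id) (h η) aemeasurable_id

/-- Since `|w (x - μ)| ≤ 1` on the support, `exp y ≤ 1 + y + y ^ 2` applies; integrating kills the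
linear term and leaves the variance, which is `μ'`. This Bernstein-type bound keeps the true
conditional variance, which a sub-Gaussian bound by `m` would lose. -/
lemma SupportedIn.exp_bound {m : ℝ} (hm : 0 < m) (h : F.SupportedIn m) (η w : ℝ)
    (hw : |w| ≤ 1 / m) :
    F.b (η + w) - F.b η - w * F.mean η ≤ deriv F.mean η * w ^ 2 := by
  set μ₀ := F.mean η with hμ
  have hμ0 := h.mean_mem η
  have hint : Integrable (fun x => Real.exp (w * x)) (F.law η) := F.integrable_exp_law η w
  have h2 : MemLp id 2 (F.law η) := by
    simpa using memLp_of_mem_interior_integrableExpSet (F.zero_mem_interior_integrableExpSet η) 2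
  have hsq : Integrable (fun x => (x - μ₀) ^ 2) (F.law η) :=
    (h2.sub (memLp_const μ₀)).integrable_sq
  have hlin : Integrable (fun x => x - μ₀) (F.law η) :=
    (F.law_integrable_id η).sub (integrable_const _)
  have hvar : ∫ x, (x - μ₀) ^ 2 ∂F.law η = deriv F.mean η := by
    rw [← variance_law, variance_eq_integral aemeasurable_id]
    simp [integral_law, hμ]
  have key : ∫ x, Real.exp (w * x) * Real.exp (-(w * μ₀)) ∂F.law η
      ≤ ∫ x, (1 + w * (x - μ₀)) + w ^ 2 * (x - μ₀) ^ 2 ∂F.law η := by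
    refine integral_mono_ae (hint.mul_const _)
      (((integrable_const _).add (hlin.const_mul _)).add (hsq.const_mul _)) ?_
    filter_upwards [h η] with x hx
    have hb : |w * (x - μ₀)| ≤ 1 := by
      rw [abs_mul]
      have : |x - μ₀| ≤ m := by
        rw [abs_le]; constructor <;> linarith [hx.1, hx.2, hμ0.1, hμ0.2]
      calc |w| * |x - μ₀| ≤ 1 / m * m := by gcongr
        _ = 1 := by field_simp
    have := (abs_le.1 (Real.abs_exp_sub_one_sub_id_le hb)).2
    rw [← Real.exp_add]
    have e : w * x + -(w * μ₀) = w * (x - μ₀) := by ring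
    rw [e]
    nlinarith
  have i1 : Integrable (fun x => 1 + w * (x - μ₀)) (F.law η) :=
    (integrable_const _).add (hlin.const_mul _)
  rw [integral_mul_const, integral_add i1 (hsq.const_mul _),
    integral_add (integrable_const _) (hlin.const_mul _),
    integral_const_mul, integral_const_mul, hvar,
    integral_sub (F.law_integrable_id η) (integrable_const _), integral_law] at key
  have hm : ∫ x, Real.exp (w * x) ∂F.law η = Real.exp (F.b (η + w) - F.b η) := by
    simpa [mgf] using F.mgf_law η w
  rw [hm, ← Real.exp_add] at key
  simp only [integral_const, probReal_univ, smul_eq_mul, one_mul, ← hμ, sub_self, mul_zero,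
    add_zero] at key
  have h3 := Real.add_one_le_exp (w ^ 2 * deriv F.mean η)
  have h4 : Real.exp (F.b (η + w) - F.b η + -(w * μ₀)) ≤ Real.exp (w ^ 2 * deriv F.mean η) := by
    linarith
  have := Real.exp_le_exp.1 h4
  linarith

namespace LinkAssumptions

variable {d : ℕ} {S kμ : ℝ} (hF : F.LinkAssumptions d S kμ)
include hF

lemma deriv_mean_nonneg (x : ℝ) : 0 ≤ deriv F.mean x :=
  (abs_nonneg _).trans (hF.self_concordant x)

lemma differentiable_mean : Differentiable ℝ F.mean := hF.contDiff_mean.differentiable (by simp)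

lemma cmu_le {θ a : Vec d} (hθ : ‖θ‖ ≤ S) (ha : ‖a‖ ≤ 1) :
    F.cmu d S ≤ deriv F.mean (inner ℝ a θ) := by
  refine csInf_le ⟨0, ?_⟩ ⟨θ, a, hθ, ha, rfl⟩
  rintro x ⟨θ, a, -, -, rfl⟩
  exact hF.deriv_mean_nonneg _

lemma deriv_mean_le (x : ℝ) : deriv F.mean x ≤ kμ := by
  have h : HasDerivAt F.mean (deriv F.mean x) x := (hF.differentiable_mean x).hasDerivAt
  refine le_of_tendsto h.tendsto_slope (Filter.eventually_of_mem self_mem_nhdsWithin ?_)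
  intro y hy
  rw [slope_def_field]
  have h1 := hF.lipschitz y x
  refine (le_abs_self _).trans ?_
  rw [abs_div, div_le_iff₀ (abs_pos.2 (sub_ne_zero.2 hy))]
  exact h1

lemma cmu_le_lipschitz (hS : 0 ≤ S) : F.cmu d S ≤ kμ :=
  (hF.cmu_le (θ := 0) (a := 0) (by simpa) (by simp)).trans (hF.deriv_mean_le _)

lemma lipschitz_pos (hS : 0 ≤ S) : 0 < kμ := hF.cmu_pos.trans_le (hF.cmu_le_lipschitz hS)

end LinkAssumptions

end ExpFamily

/-! ### Generalized self-concordance. -/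

lemma exp_neg_le_one_div {h : ℝ} (hh : 0 ≤ h) : h / (1 + h) ≤ 1 - Real.exp (-h) := by
  have h1 := Real.add_one_le_exp h
  have : Real.exp (-h) ≤ 1 / (1 + h) := by
    rw [Real.exp_neg, ← one_div]
    exact one_div_le_one_div_of_le (by linarith) (by linarith)
  have e : h / (1 + h) = 1 - 1 / (1 + h) := by field_simp; ring
  linarith

/-- A generalized self-concordant function grows at least as fast as `h / (1 + h)`. -/
lemma selfConcordant_sub_ge {f : ℝ → ℝ} (hf : Differentiable ℝ f)
    (hf' : Differentiable ℝ (deriv f)) (hsc : ∀ x, |deriv (deriv f) x| ≤ deriv f x)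
    (x : ℝ) {h : ℝ} (hh : 0 ≤ h) :
    deriv f x * (h / (1 + h)) ≤ f (x + h) - f x := by
  -- `f'' ≥ -f'` makes `f' exp` nondecreasing, so `f' y ≥ f' x exp (x - y)` to the right of `x`;
  -- integrated, this is the monotonicity of `f y + f' x exp (x - y)`.
  have hd0 : 0 ≤ deriv f x := (abs_nonneg _).trans (hsc x)
  have mono1 : Monotone fun y => deriv f y * Real.exp y := by
    have hD : ∀ y, HasDerivAt (fun y => deriv f y * Real.exp y)
        (deriv (deriv f) y * Real.exp y + deriv f y * Real.exp y) y := fun y =>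
      (hf' y).hasDerivAt.mul (Real.hasDerivAt_exp y)
    refine monotone_of_deriv_nonneg (fun y => (hD y).differentiableAt) fun y => ?_
    rw [(hD y).deriv, ← add_mul]
    have := (abs_le.1 (hsc y)).1
    exact mul_nonneg (by linarith) (Real.exp_pos _).le
  have hD : ∀ y, HasDerivAt (fun y => f y + deriv f x * Real.exp (x - y))
      (deriv f y + deriv f x * (Real.exp (x - y) * (0 - 1))) y := fun y =>
    (hf y).hasDerivAt.add (((((hasDerivAt_const y x).sub (hasDerivAt_id y))).exp).const_mul _)
  have mono2 : MonotoneOn (fun y => f y + deriv f x * Real.exp (x - y)) (Set.Ici x) := by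
    refine monotoneOn_of_deriv_nonneg (convex_Ici x)
      (fun y _ => (hD y).continuousAt.continuousWithinAt)
      (fun y _ => (hD y).differentiableAt.differentiableWithinAt) fun y hy => ?_
    rw [interior_Ici] at hy
    rw [(hD y).deriv]
    have h1 := mono1 (le_of_lt hy)
    simp only at h1
    have h2 : deriv f x * Real.exp (x - y) ≤ deriv f y := by
      rw [Real.exp_sub, mul_div_assoc', div_le_iff₀ (Real.exp_pos _)]
      exact h1
    linarith
  have h3 := mono2 (Set.mem_Ici.2 le_rfl) (Set.mem_Ici.2 (by linarith : x ≤ x + h)) (by linarith)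
  simp only [sub_self, Real.exp_zero, mul_one, sub_add_cancel_left] at h3
  have := mul_le_mul_of_nonneg_left (exp_neg_le_one_div hh) hd0
  linarith

lemma selfConcordant_mul_sub_ge {f : ℝ → ℝ} (hf : Differentiable ℝ f)
    (hf' : Differentiable ℝ (deriv f)) (hsc : ∀ x, |deriv (deriv f) x| ≤ deriv f x)
    (x h : ℝ) : deriv f x * (h ^ 2 / (1 + |h|)) ≤ (f (x + h) - f x) * h := by
  rcases le_total 0 h with hh | hh
  · rw [abs_of_nonneg hh]
    have := mul_le_mul_of_nonneg_right (selfConcordant_sub_ge hf hf' hsc x hh) hh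
    calc _ = deriv f x * (h / (1 + h)) * h := by ring
      _ ≤ _ := this
  -- Negative increments reduce to positive ones: the reflection `g` satisfies the same hypotheses.
  · set g : ℝ → ℝ := fun y => -f (-y) with hg
    have hg1 : deriv g = fun y => deriv f (-y) := by
      ext y
      simp only [hg]
      rw [deriv.fun_neg, deriv_comp_neg, neg_neg]
    have hg2 : deriv (deriv g) = fun y => - deriv (deriv f) (-y) := by
      ext y
      rw [hg1, deriv_comp_neg]
    have := selfConcordant_sub_ge (f := g) (hf.comp differentiable_neg).neg
      (by rw [hg1]; exact hf'.comp differentiable_neg)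
      (fun y => by rw [hg2, hg1, abs_neg]; exact hsc _) (-x) (h := -h) (by linarith)
    rw [hg1] at this
    simp only [hg, neg_neg, neg_add] at this
    rw [abs_of_nonpos hh]
    have := mul_le_mul_of_nonneg_right this (neg_nonneg.2 hh)
    calc _ = deriv f x * (-h / (1 + -h)) * -h := by ring
      _ ≤ _ := this
      _ = _ := by ring


/-! ### Regularized Gram matrices, determinants and the elliptical potential. -/

section Gram

open Matrix

variable {d : ℕ}

/-- The regularized weighted Gram matrix `∑ s ∈ W, c s • x s (x s)ᵀ + l I`. -/
noncomputable def weightedGram (W : Finset ℕ) (c : ℕ → ℝ) (x : ℕ → Vec d) (l : ℝ) :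
    Matrix (Fin d) (Fin d) ℝ :=
  ∑ s ∈ W, c s • vecMulVec (x s).ofLp (x s).ofLp + l • (1 : Matrix (Fin d) (Fin d) ℝ)

/-- The quadratic form of `weightedGram`. -/
noncomputable def gramForm (W : Finset ℕ) (c : ℕ → ℝ) (x : ℕ → Vec d) (l : ℝ) (v : Vec d) : ℝ :=
  ∑ s ∈ W, c s * inner ℝ (x s) v ^ 2 + l * ‖v‖ ^ 2

lemma inner_eq_dotProduct (x y : Vec d) : inner ℝ x y = x.ofLp ⬝ᵥ y.ofLp := by
  rw [EuclideanSpace.inner_eq_star_dotProduct, dotProduct_comm]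
  rfl

lemma dotProduct_weightedGram (W : Finset ℕ) (c : ℕ → ℝ) (x : ℕ → Vec d) (l : ℝ) (v : Vec d) :
    v.ofLp ⬝ᵥ weightedGram W c x l *ᵥ v.ofLp = gramForm W c x l v := by
  have h : v.ofLp ⬝ᵥ v.ofLp = ‖v‖ ^ 2 := by
    rw [← inner_eq_dotProduct, real_inner_self_eq_norm_sq]
  rw [weightedGram, gramForm, add_mulVec, dotProduct_add, sum_mulVec, dotProduct_sum, smul_mulVec,
    one_mulVec, dotProduct_smul, h, smul_eq_mul]
  congr 1
  refine Finset.sum_congr rfl fun s _ => ?_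
  rw [smul_mulVec, dotProduct_smul, vecMulVec_mulVec, inner_eq_dotProduct, smul_eq_mul]
  rw [op_smul_eq_smul, dotProduct_smul, smul_eq_mul, dotProduct_comm v.ofLp]
  ring

lemma weightedGram_isHermitian (W : Finset ℕ) (c : ℕ → ℝ) (x : ℕ → Vec d) (l : ℝ) :
    (weightedGram W c x l).IsHermitian := by
  rw [IsHermitian, weightedGram, conjTranspose_add, conjTranspose_sum]
  simp

lemma gramForm_ge {W : Finset ℕ} {c : ℕ → ℝ} (hc : ∀ s ∈ W, 0 ≤ c s) (x : ℕ → Vec d) (l : ℝ)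
    (v : Vec d) : l * ‖v‖ ^ 2 ≤ gramForm W c x l v := by
  have : 0 ≤ ∑ s ∈ W, c s * inner ℝ (x s) v ^ 2 :=
    Finset.sum_nonneg fun s hs => mul_nonneg (hc s hs) (sq_nonneg _)
  rw [gramForm]
  linarith

lemma weightedGram_posDef {W : Finset ℕ} {c : ℕ → ℝ} (hc : ∀ s ∈ W, 0 ≤ c s) (x : ℕ → Vec d)
    {l : ℝ} (hl : 0 < l) : (weightedGram W c x l).PosDef := by
  refine PosDef.of_dotProduct_mulVec_pos (weightedGram_isHermitian W c x l) fun y hy => ?_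
  have h := dotProduct_weightedGram W c x l (WithLp.toLp 2 y)
  simp only [star_trivial] at h ⊢
  rw [h]
  refine lt_of_lt_of_le ?_ (gramForm_ge hc x l _)
  have : 0 < ‖WithLp.toLp 2 y‖ := norm_pos_iff.2 (by simpa using hy)
  positivity

lemma exists_factor_of_posSemidef {M : Matrix (Fin d) (Fin d) ℝ} (hM : M.PosSemidef) :
    ∃ B : Matrix (Fin d) (Fin d) ℝ, M = Bᵀ * B := by
  open scoped MatrixOrder in
  obtain ⟨B, hB⟩ := CStarAlgebra.nonneg_iff_eq_star_mul_self.1 hM.nonneg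
  exact ⟨B, by rw [hB]; simp [star_eq_conjTranspose]⟩

/-- Cauchy–Schwarz for `B y` and `B z`, where `M = Bᵀ B` and `x = M z`. -/
lemma dotProduct_sq_le_of_posDef {M : Matrix (Fin d) (Fin d) ℝ} (hM : M.PosDef)
    (x y : Fin d → ℝ) : (x ⬝ᵥ y) ^ 2 ≤ (x ⬝ᵥ M⁻¹ *ᵥ x) * (y ⬝ᵥ M *ᵥ y) := by
  have hdet : IsUnit M.det := hM.det_pos.ne'.isUnit
  obtain ⟨B, hB⟩ := exists_factor_of_posSemidef hM.posSemidef
  have key : ∀ u v : Fin d → ℝ, u ⬝ᵥ M *ᵥ v = (B *ᵥ u) ⬝ᵥ (B *ᵥ v) := by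
    intro u v
    rw [hB, ← mulVec_mulVec, dotProduct_mulVec, vecMul_transpose]
  set z := M⁻¹ *ᵥ x with hz
  have hx : x = M *ᵥ z := by rw [hz, mulVec_mulVec, mul_nonsing_inv _ hdet, one_mulVec]
  have h1 : x ⬝ᵥ y = (B *ᵥ y) ⬝ᵥ (B *ᵥ z) := by rw [← key, ← hx, dotProduct_comm]
  have h2 : x ⬝ᵥ z = (B *ᵥ z) ⬝ᵥ (B *ᵥ z) := by rw [← key, ← hx, dotProduct_comm]
  rw [h1, h2, key]
  have := Finset.sum_mul_sq_le_sq_mul_sq Finset.univ (B *ᵥ z) (B *ᵥ y)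
  simpa only [dotProduct, pow_two, mul_comm] using this

/-- With `y = V⁻¹ x`, Cauchy–Schwarz gives `(xᵀ y)² ≤ (xᵀ W⁻¹ x) (yᵀ W y) ≤ (xᵀ W⁻¹ x) (xᵀ y)`, and
one factor `xᵀ y` cancels. -/
lemma inv_form_anti {V W : Matrix (Fin d) (Fin d) ℝ} (hV : V.PosDef) (hW : W.PosDef)
    (h : ∀ y, y ⬝ᵥ W *ᵥ y ≤ y ⬝ᵥ V *ᵥ y) (x : Fin d → ℝ) :
    x ⬝ᵥ V⁻¹ *ᵥ x ≤ x ⬝ᵥ W⁻¹ *ᵥ x := by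
  have hdet : IsUnit V.det := hV.det_pos.ne'.isUnit
  set y := V⁻¹ *ᵥ x with hy
  have hx : V *ᵥ y = x := by rw [hy, mulVec_mulVec, mul_nonsing_inv _ hdet, one_mulVec]
  have h1 := dotProduct_sq_le_of_posDef hW x y
  have h2 := h y
  rw [hx, dotProduct_comm y x] at h2
  have h3 : 0 ≤ x ⬝ᵥ W⁻¹ *ᵥ x := by
    have := hW.inv.posSemidef.dotProduct_mulVec_nonneg x
    simpa using this
  have h4 : 0 ≤ x ⬝ᵥ y := by
    have := hV.inv.posSemidef.dotProduct_mulVec_nonneg x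
    simpa [hy] using this
  by_contra! hlt
  have h5 : 0 < x ⬝ᵥ y := h3.trans_lt hlt
  nlinarith [mul_le_mul_of_nonneg_left h2 h3]

lemma det_add_vecMulVec {M : Matrix (Fin d) (Fin d) ℝ} (hM : M.PosDef) (x : Fin d → ℝ) :
    (M + vecMulVec x x).det = M.det * (1 + x ⬝ᵥ M⁻¹ *ᵥ x) := by
  have hdet : IsUnit M.det := hM.det_pos.ne'.isUnit
  rw [vecMulVec_eq Unit, det_add_replicateCol_mul_replicateRow hdet,
    det_unique (n := Unit)]
  congr 1
  rw [Matrix.mul_assoc, ← replicateCol_mulVec]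
  simp [replicateRow_mul_replicateCol_apply]

/-- The inequality of arithmetic and geometric means for the eigenvalues. -/
lemma det_le_trace_div_pow (hd : 1 ≤ d) {M : Matrix (Fin d) (Fin d) ℝ} (hM : M.PosSemidef) :
    M.det ≤ (M.trace / d) ^ d := by
  have hd0 : (0 : ℝ) < d := by exact_mod_cast hd
  have h1 := hM.1.det_eq_prod_eigenvalues
  have h2 := hM.1.trace_eq_sum_eigenvalues
  simp only [RCLike.ofReal_real_eq_id, id] at h1 h2
  rw [h1, h2]
  have h := Real.geom_mean_le_arith_mean Finset.univ (fun _ => 1) hM.1.eigenvalues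
    (fun _ _ => zero_le_one) (by simpa using Nat.zero_lt_of_lt hd) (fun i _ => hM.eigenvalues_nonneg i)
  simp only [Real.rpow_one, Finset.sum_const, Finset.card_univ, Fintype.card_fin, nsmul_eq_mul,
    mul_one, one_mul] at h
  have hp : 0 ≤ ∏ i, hM.1.eigenvalues i := Finset.prod_nonneg fun i _ => hM.eigenvalues_nonneg i
  calc ∏ i, hM.1.eigenvalues i = ((∏ i, hM.1.eigenvalues i) ^ ((d : ℝ)⁻¹)) ^ d := by
        rw [← Real.rpow_natCast, ← Real.rpow_mul hp, inv_mul_cancel₀ hd0.ne', Real.rpow_one]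
    _ ≤ _ := by gcongr

lemma weightedGram_det_le (hd : 1 ≤ d) {W : Finset ℕ} {c : ℕ → ℝ} {x : ℕ → Vec d} {l K : ℝ}
    (hl : 0 < l) (hc : ∀ s ∈ W, 0 ≤ c s) (hcK : ∀ s ∈ W, c s ≤ K) (hx : ∀ s ∈ W, ‖x s‖ ≤ 1) :
    (weightedGram W c x l).det ≤ l ^ d * (1 + K * W.card / (d * l)) ^ d := by
  have hd0 : (0 : ℝ) < d := by exact_mod_cast hd
  have hpd := weightedGram_posDef hc x hl
  refine (det_le_trace_div_pow hd hpd.posSemidef).trans ?_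
  rw [← mul_pow]
  have htr : (weightedGram W c x l).trace ≤ W.card * K + d * l := by
    rw [weightedGram, trace_add, trace_sum, trace_smul, trace_one, Fintype.card_fin, smul_eq_mul,
      mul_comm l, ← nsmul_eq_mul]
    refine add_le_add ((Finset.sum_le_card_nsmul _ _ K fun s hs => ?_).trans_eq
      (nsmul_eq_mul _ _)) le_rfl
    rw [trace_smul, trace_vecMulVec, ← inner_eq_dotProduct, real_inner_self_eq_norm_sq,
      smul_eq_mul]
    have : ‖x s‖ ^ 2 ≤ 1 := pow_le_one₀ (norm_nonneg _) (hx s hs)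
    nlinarith [hc s hs, hcK s hs]
  have htr0 : 0 ≤ (weightedGram W c x l).trace := by
    have := hpd.posSemidef.trace_nonneg
    simpa using this
  refine pow_le_pow_left₀ (by positivity) ?_ _
  rw [div_le_iff₀ hd0]
  have : l * (1 + K * W.card / (d * l)) * d = W.card * K + d * l := by
    field_simp
    ring
  linarith

/-- Below `1` the logarithm is at least `x / 2`; above `1` it is at least `log 2 > 1 / 2`. Applied
to a squared inverse norm, it makes the potential telescope. -/
lemma le_two_mul_max_mul_log {x M : ℝ} (hx : 0 ≤ x) (hM : x ≤ M) :
    x ≤ 2 * max 1 M * Real.log (1 + x) := by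
  have hlog0 : 0 ≤ Real.log (1 + x) := Real.log_nonneg (by linarith)
  rcases le_total x 1 with h | h
  · have h1 : x / (1 + x) ≤ Real.log (1 + x) := by
      have := Real.one_sub_inv_le_log_of_pos (show 0 < 1 + x by linarith)
      have e : x / (1 + x) = 1 - (1 + x)⁻¹ := by field_simp; ring
      linarith
    have h2 : x / 2 ≤ x / (1 + x) := by gcongr; linarith
    have h3 : (1 : ℝ) ≤ max 1 M := le_max_left _ _
    nlinarith
  · have h1 : Real.log 2 ≤ Real.log (1 + x) := Real.log_le_log (by norm_num) (by linarith)
    have h2 := Real.log_two_gt_d9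
    have h3 : x ≤ max 1 M := hM.trans (le_max_right _ _)
    nlinarith

lemma inv_form_nonneg {M : Matrix (Fin d) (Fin d) ℝ} (hM : M.PosDef) (x : Fin d → ℝ) :
    0 ≤ x ⬝ᵥ M⁻¹ *ᵥ x := by
  simpa using hM.inv.posSemidef.dotProduct_mulVec_nonneg x

lemma inv_form_weightedGram_le {W : Finset ℕ} {c : ℕ → ℝ} (hc : ∀ s ∈ W, 0 ≤ c s)
    (x : ℕ → Vec d) {l : ℝ} (hl : 0 < l) (v : Vec d) :
    v.ofLp ⬝ᵥ (weightedGram W c x l)⁻¹ *ᵥ v.ofLp ≤ ‖v‖ ^ 2 / l := by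
  have hpd := weightedGram_posDef hc x hl
  have hpd0 := weightedGram_posDef (W := ∅) (c := c) (by simp) x hl
  refine (inv_form_anti hpd hpd0 (fun y => ?_) v.ofLp).trans (le_of_eq ?_)
  · have h1 := dotProduct_weightedGram W c x l (WithLp.toLp 2 y)
    have h2 := dotProduct_weightedGram ∅ c x l (WithLp.toLp 2 y)
    simp only at h1 h2
    rw [h1, h2]
    simpa [gramForm] using Finset.sum_nonneg fun s hs => mul_nonneg (hc s hs) (sq_nonneg _)
  · have e : (weightedGram ∅ c x l)⁻¹ = l⁻¹ • (1 : Matrix (Fin d) (Fin d) ℝ) := by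
      refine inv_eq_left_inv ?_
      simp [weightedGram, smul_smul, mul_inv_cancel₀ hl.ne']
    rw [e, smul_mulVec, one_mulVec, dotProduct_smul, ← inner_eq_dotProduct,
      real_inner_self_eq_norm_sq, smul_eq_mul]
    ring

/-- The elliptical potential of consecutive vectors. -/
lemma sum_inv_form_le_log_det {x : ℕ → Vec d} {l : ℝ} (hl : 0 < l) (p q : ℕ) (hpq : p ≤ q)
    (hx : ∀ s ∈ Finset.Ico p q, ‖x s‖ ≤ 1) :
    ∑ t ∈ Finset.Ico p q,
        (x t).ofLp ⬝ᵥ (weightedGram (Finset.Ico p t) (fun _ => 1) x l)⁻¹ *ᵥ (x t).ofLp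
      ≤ 2 * max 1 (1 / l) *
        (Real.log (weightedGram (Finset.Ico p q) (fun _ => 1) x l).det - Real.log (l ^ d)) := by
  induction q, hpq using Nat.le_induction with
  | base => simp [weightedGram]
  | succ q hpq ih =>
    have ih := ih fun s hs => hx s (by simp at hs ⊢; omega)
    rw [Finset.sum_Ico_succ_top hpq]
    set M := weightedGram (Finset.Ico p q) (fun _ => 1) x l with hMdef
    have hM : M.PosDef := weightedGram_posDef (fun _ _ => zero_le_one) x hl
    have hstep : weightedGram (Finset.Ico p (q + 1)) (fun _ => 1) x l
        = M + vecMulVec (x q).ofLp (x q).ofLp := by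
      rw [hMdef, weightedGram, weightedGram, Finset.sum_Ico_succ_top hpq, one_smul]
      abel
    have hn : ‖x q‖ ≤ 1 := hx q (by simp; omega)
    have h0 := inv_form_nonneg hM (x q).ofLp
    have h1 : (x q).ofLp ⬝ᵥ M⁻¹ *ᵥ (x q).ofLp ≤ 1 / l := by
      refine (inv_form_weightedGram_le (fun _ _ => zero_le_one) x hl (x q)).trans ?_
      gcongr
      exact pow_le_one₀ (norm_nonneg _) hn
    -- The log-determinant grows by exactly `log (1 + xᵀ M⁻¹ x)`, so the sum telescopes.
    rw [hstep, det_add_vecMulVec hM, Real.log_mul hM.det_pos.ne' (by positivity)]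
    have := le_two_mul_max_mul_log h0 h1
    linarith

lemma sum_inv_form_le (hd : 1 ≤ d) {x : ℕ → Vec d} {l : ℝ} (hl : 0 < l) (p q τ : ℕ) (hpq : p ≤ q)
    (hτ : q - p ≤ τ) (hx : ∀ s ∈ Finset.Ico p q, ‖x s‖ ≤ 1) :
    ∑ t ∈ Finset.Ico p q,
        (x t).ofLp ⬝ᵥ (weightedGram (Finset.Ico p t) (fun _ => 1) x l)⁻¹ *ᵥ (x t).ofLp
      ≤ 2 * max 1 (1 / l) * (d * Real.log (1 + τ / (d * l))) := by
  have hd0 : (0 : ℝ) < d := by exact_mod_cast hd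
  refine (sum_inv_form_le_log_det hl p q hpq hx).trans ?_
  refine mul_le_mul_of_nonneg_left ?_ (by positivity)
  have hpd : (weightedGram (Finset.Ico p q) (fun _ => 1) x l).PosDef :=
    weightedGram_posDef (fun _ _ => zero_le_one) x hl
  have h1 := weightedGram_det_le hd hl (fun _ _ => zero_le_one) (fun _ _ => le_rfl) hx
  have h2 := Real.log_le_log hpd.det_pos h1
  rw [Real.log_mul (by positivity) (by positivity), Real.log_pow (n := d) (x := 1 + _)] at h2
  have h3 : Real.log (1 + 1 * (Finset.Ico p q).card / (d * l)) ≤ Real.log (1 + τ / (d * l)) := by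
    refine Real.log_le_log (by positivity) ?_
    rw [one_mul, Nat.card_Ico]
    gcongr
  have := mul_le_mul_of_nonneg_left h3 hd0.le
  linarith

end Gram


/-! ### Conditional exponential moments of a reward. -/

namespace ExpFamily

variable (F : ExpFamily)

lemma measurable_law : Measurable F.law := by
  refine Measure.measurable_of_measurable_coe _ fun B hB => ?_
  have hb : Continuous F.b := F.contDiff_b.continuous
  have h : ∀ η, F.law η B = ∫⁻ r in B,
      ENNReal.ofReal (Real.exp (r * (η - 0) - F.b η + F.b 0)) ∂F.law 0 := fun η => by
    rw [F.law_eq_withDensity 0 η, withDensity_apply _ hB]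
  simp_rw [h]
  refine Measurable.lintegral_prod_right' (f := fun p : ℝ × ℝ =>
    ENNReal.ofReal (Real.exp (p.2 * (p.1 - 0) - F.b p.1 + F.b 0))) ?_
  fun_prop

/-- The laws of the family as a Markov kernel in the natural parameter. -/
noncomputable def lawKernel : Kernel ℝ ℝ := ⟨F.law, F.measurable_law⟩

instance : IsMarkovKernel F.lawKernel := ⟨fun η => F.isProbabilityMeasure_law η⟩

variable {Ω E : Type*} {𝒢 mΩ : MeasurableSpace Ω} [MeasurableSpace E] {P : Measure Ω}
  [IsProbabilityMeasure P] {r η : Ω → ℝ}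

/-- The conditional law is given one Borel set at a time, each with its own null set. Testing on
rectangles turns it into an identity of joint laws, after which the variables known to `𝒢` can be
frozen while integrating over the reward. -/
lemma map_prodMk_eq_compProd (h𝒢 : 𝒢 ≤ mΩ) (hr : Measurable r) {Y : Ω → E}
    (hY : Measurable[𝒢] Y) {e : E → ℝ} (he : Measurable e)
    (hlaw : ∀ B : Set ℝ, MeasurableSet B →
      P[Set.indicator (r ⁻¹' B) (fun _ => (1 : ℝ)) | 𝒢]
        =ᵐ[P] fun ω => (F.law (e (Y ω))).real B) :
    P.map (fun ω => (Y ω, r ω)) = (P.map Y) ⊗ₘ (F.lawKernel.comap e he) := by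
  have hY' : Measurable Y := hY.mono h𝒢 le_rfl
  have : IsProbabilityMeasure (P.map Y) := Measure.isProbabilityMeasure_map hY'.aemeasurable
  have : IsProbabilityMeasure (P.map fun ω => (Y ω, r ω)) :=
    Measure.isProbabilityMeasure_map (hY'.prodMk hr).aemeasurable
  refine Measure.ext_prod fun {s t} hs ht => ?_
  rw [Measure.map_apply (hY'.prodMk hr) (hs.prod ht), Measure.compProd_apply_prod hs ht,
    setLIntegral_map hs (Kernel.measurable_coe _ ht) hY']
  have hint : Integrable (Set.indicator (r ⁻¹' t) (fun _ => (1 : ℝ))) P :=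
    (integrable_const _).indicator (hr ht)
  have h1 : ∫ ω in Y ⁻¹' s, (F.law (e (Y ω))).real t ∂P
      = ∫ ω in Y ⁻¹' s, Set.indicator (r ⁻¹' t) (fun _ => (1 : ℝ)) ω ∂P := by
    rw [← setIntegral_condExp h𝒢 hint (hY hs)]
    exact (setIntegral_congr_ae (hY' hs) ((hlaw t ht).mono fun ω h _ => h)).symm
  have h2 : ∫ ω in Y ⁻¹' s, Set.indicator (r ⁻¹' t) (fun _ => (1 : ℝ)) ω ∂P
      = P.real (Y ⁻¹' s ∩ r ⁻¹' t) := by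
    rw [setIntegral_indicator (hr ht)]
    simp
  have hm : Measurable fun ω => F.law (e (Y ω)) t :=
    (Measure.measurable_coe ht).comp (F.measurable_law.comp (he.comp hY'))
  have h3 : ∫ ω in Y ⁻¹' s, (F.law (e (Y ω))).real t ∂P
      = (∫⁻ ω in Y ⁻¹' s, F.law (e (Y ω)) t ∂P).toReal :=
    integral_toReal hm.aemeasurable (Filter.Eventually.of_forall fun ω => measure_lt_top _ _)
  have hfin : ∫⁻ ω in Y ⁻¹' s, F.law (e (Y ω)) t ∂P ≠ ⊤ := by
    refine ne_top_of_le_ne_top (b := ∫⁻ ω in Y ⁻¹' s, 1 ∂P) (by simp) ?_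
    exact lintegral_mono fun ω => prob_le_one
  rw [h1, h2] at h3
  have h4 := (ENNReal.toReal_eq_toReal_iff' (measure_ne_top _ _) hfin).1 h3
  exact h4

lemma lintegral_mul_exp_reward (h𝒢 : 𝒢 ≤ mΩ) (hr : Measurable r) {Z : Ω → ENNReal} {w : Ω → ℝ}
    (hZ : Measurable[𝒢] Z) (hw : Measurable[𝒢] w) (hη : Measurable[𝒢] η)
    (hlaw : ∀ B : Set ℝ, MeasurableSet B →
      P[Set.indicator (r ⁻¹' B) (fun _ => (1 : ℝ)) | 𝒢] =ᵐ[P] fun ω => (F.law (η ω)).real B) :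
    ∫⁻ ω, Z ω * ENNReal.ofReal (Real.exp (w ω * r ω)) ∂P
      = ∫⁻ ω, Z ω * ENNReal.ofReal (Real.exp (F.b (η ω + w ω) - F.b (η ω))) ∂P := by
  -- Everything known before the reward is packed into `Y`; the natural parameter is its last
  -- coordinate.
  set Y : Ω → ENNReal × ℝ × ℝ := fun ω => (Z ω, w ω, η ω) with hYdef
  have hY : Measurable[𝒢] Y := hZ.prodMk (hw.prodMk hη)
  have hY' : Measurable Y := hY.mono h𝒢 le_rfl
  have he : Measurable fun y : ENNReal × ℝ × ℝ => y.2.2 := by fun_prop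
  have hb : Continuous F.b := F.contDiff_b.continuous
  have key := F.map_prodMk_eq_compProd (P := P) h𝒢 hr hY he hlaw
  set g : (ENNReal × ℝ × ℝ) × ℝ → ENNReal :=
    fun p => p.1.1 * ENNReal.ofReal (Real.exp (p.1.2.1 * p.2)) with hg
  have hgm : Measurable g := by fun_prop
  have hL : ∫⁻ ω, Z ω * ENNReal.ofReal (Real.exp (w ω * r ω)) ∂P
      = ∫⁻ p, g p ∂(P.map fun ω => (Y ω, r ω)) := by
    rw [lintegral_map hgm (hY'.prodMk hr)]
  rw [hL, key, Measure.lintegral_compProd hgm, lintegral_map ?_ hY']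
  · refine lintegral_congr fun ω => ?_
    simp only [hg, hYdef]
    rw [lintegral_const_mul _ (by fun_prop)]
    congr 1
    exact F.lintegral_exp_law (η ω) (w ω)
  · exact hgm.lintegral_kernel_prod_right'

lemma lintegral_mul_exp_noise_le (h𝒢 : 𝒢 ≤ mΩ) (hr : Measurable r) {m : ℝ} (hm : 0 < m)
    (hsupp : F.SupportedIn m) (hμ : Continuous F.mean) (hμ' : Continuous (deriv F.mean))
    {Z : Ω → ENNReal} {w : Ω → ℝ}
    (hZ : Measurable[𝒢] Z) (hw : Measurable[𝒢] w) (hη : Measurable[𝒢] η)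
    (hwm : ∀ᵐ ω ∂P, |w ω| ≤ 1 / m)
    (hlaw : ∀ B : Set ℝ, MeasurableSet B →
      P[Set.indicator (r ⁻¹' B) (fun _ => (1 : ℝ)) | 𝒢] =ᵐ[P] fun ω => (F.law (η ω)).real B) :
    ∫⁻ ω, Z ω * ENNReal.ofReal (Real.exp (w ω * (r ω - F.mean (η ω))
        - deriv F.mean (η ω) * w ω ^ 2)) ∂P ≤ ∫⁻ ω, Z ω ∂P := by
  set Z' : Ω → ENNReal := fun ω => Z ω *
    ENNReal.ofReal (Real.exp (-(w ω * F.mean (η ω)) - deriv F.mean (η ω) * w ω ^ 2)) with hZ'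
  have hZ'm : Measurable[𝒢] Z' := by
    have h1 := hμ.measurable.comp hη
    have h2 := hμ'.measurable.comp hη
    exact hZ.mul (ENNReal.measurable_ofReal.comp (Real.measurable_exp.comp
      ((hw.mul h1).neg.sub (h2.mul (hw.pow_const 2)))))
  have e1 : ∀ ω, Z ω * ENNReal.ofReal (Real.exp (w ω * (r ω - F.mean (η ω))
        - deriv F.mean (η ω) * w ω ^ 2)) = Z' ω * ENNReal.ofReal (Real.exp (w ω * r ω)) := by
    intro ω
    rw [hZ', mul_assoc, ← ENNReal.ofReal_mul (Real.exp_pos _).le, ← Real.exp_add]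
    congr 3
    ring
  simp_rw [e1]
  rw [F.lintegral_mul_exp_reward h𝒢 hr hZ'm hw hη hlaw]
  refine lintegral_mono_ae ?_
  filter_upwards [hwm] with ω hω
  rw [hZ', mul_assoc, ← ENNReal.ofReal_mul (Real.exp_pos _).le, ← Real.exp_add]
  refine mul_le_of_le_one_right' ?_
  rw [ENNReal.ofReal_le_one, Real.exp_le_one_iff]
  have := hsupp.exp_bound hm (η ω) (w ω) hω
  linarith

end ExpFamily

/-! ### The score and its exponential supermartingale. -/

section Bandit

variable {d : ℕ} {Ω : Type*} [MeasurableSpace Ω] {F : ExpFamily} {P : Measure Ω}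
  {ℱ : Filtration ℕ ‹MeasurableSpace Ω›} {T : ℕ} {S m kμ : ℝ} {θ : ℕ → Vec d}
  {A : ℕ → Ω → Set (Vec d)} {a : ℕ → Ω → Vec d} {r : ℕ → Ω → ℝ}

/-- The score `∑ s ∈ W, (r (s + 1) - μ (a sᵀ θ s)) a s`. -/
noncomputable def score (F : ExpFamily) (W : Finset ℕ) (θ : ℕ → Vec d) (a : ℕ → Vec d)
    (r : ℕ → ℝ) : Vec d :=
  ∑ s ∈ W, (r (s + 1) - F.mean (inner ℝ (a s) (θ s))) • a s

lemma inner_score (W : Finset ℕ) (θ : ℕ → Vec d) (a : ℕ → Vec d) (r : ℕ → ℝ) (v : Vec d) :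
    inner ℝ (score F W θ a r) v
      = ∑ s ∈ W, inner ℝ (a s) v * (r (s + 1) - F.mean (inner ℝ (a s) (θ s))) := by
  rw [score, sum_inner]
  refine Finset.sum_congr rfl fun s _ => ?_
  rw [real_inner_smul_left, mul_comm]

namespace IsBandit

variable (hB : IsBandit F P ℱ T S m θ A a r)
include hB

lemma supportedIn [IsProbabilityMeasure P] (hT : 1 ≤ T) : F.SupportedIn m := by
  have h1T : 1 ∈ Finset.Icc 1 T := by simpa using hT
  have hlaw := hB.reward_law 1 h1T (Set.Icc 0 m)ᶜ measurableSet_Icc.compl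
  have h0 : Set.indicator (r (1 + 1) ⁻¹' (Set.Icc 0 m)ᶜ) (fun _ => (1 : ℝ)) =ᵐ[P] 0 := by
    filter_upwards [hB.reward_bounded] with ω hω
    have := hω 1 h1T
    simp only [Set.indicator_apply_eq_zero, Set.mem_preimage, Set.mem_compl_iff, Set.mem_Icc,
      Pi.zero_apply]
    intro h
    exact absurd this h
  have h1 := (condExp_congr_ae (m := ℱ 1) h0).symm.trans hlaw
  rw [condExp_zero] at h1
  -- One outcome suffices: it exhibits one law of the family supported in `[0, m]`, and the laws are
  -- equivalent.
  obtain ⟨ω, hω⟩ := h1.exists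
  refine ExpFamily.SupportedIn.of_law (η₀ := inner ℝ (a 1 ω) (θ 1)) ?_
  simp only [Pi.zero_apply] at hω
  rw [ae_iff]
  exact (measureReal_eq_zero_iff).1 hω.symm

lemma measurable_action {s : ℕ} (hs : s ∈ Finset.Icc 1 T) : Measurable (a s) :=
  ((hB.action_measurable s hs).mono (ℱ.le s)).measurable

lemma measurable_reward {s : ℕ} (hs : s ∈ Finset.Icc 1 T) : Measurable (r (s + 1)) :=
  ((hB.reward_measurable s hs).mono (ℱ.le _)).measurable

/-- The last factor has conditional expectation at most one, and the others are known before the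
last reward. The starting round `p` is arbitrary, so every sliding window gets a process of its own.
-/
lemma lintegral_exp_score_le_one [IsProbabilityMeasure P] (hT : 1 ≤ T) (hm : 0 < m)
    (hF : F.LinkAssumptions d S kμ) (u : Vec d) (hu : ‖u‖ ≤ 1 / m) {p q : ℕ} (hp : 1 ≤ p)
    (hpq : p ≤ q) (hq : q ≤ T + 1) :
    ∫⁻ ω, ENNReal.ofReal (Real.exp (∑ s ∈ Finset.Ico p q,
      (inner ℝ (a s ω) u * (r (s + 1) ω - F.mean (inner ℝ (a s ω) (θ s)))
        - deriv F.mean (inner ℝ (a s ω) (θ s)) * inner ℝ (a s ω) u ^ 2))) ∂P ≤ 1 := by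
  have hμ : Continuous F.mean := hF.differentiable_mean.continuous
  have hμ' : Continuous (deriv F.mean) := hF.differentiable_deriv.continuous
  induction q, hpq using Nat.le_induction with
  | base => simp
  | succ q hpq ih =>
    refine le_trans ?_ (ih (by omega))
    have hqT : q ∈ Finset.Icc 1 T := by simp; omega
    have haq : Measurable[ℱ q] (a q) := (hB.action_measurable q hqT).measurable
    simp_rw [Finset.sum_Ico_succ_top hpq, Real.exp_add, ENNReal.ofReal_mul (Real.exp_pos _).le]
    refine F.lintegral_mul_exp_noise_le (ℱ.le q) (hB.measurable_reward hqT) hm (hB.supportedIn hT)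
      hμ hμ' ?_ (haq.inner_const) (haq.inner_const) ?_ (hB.reward_law q hqT)
    · refine ENNReal.measurable_ofReal.comp (Real.measurable_exp.comp
        (Finset.measurable_fun_sum _ fun s hs => ?_))
      have hs' : p ≤ s ∧ s < q := by simpa using hs
      have hsT : s ∈ Finset.Icc 1 T := by simp; omega
      have h1 : Measurable[ℱ q] (a s) :=
        ((hB.action_measurable s hsT).mono (ℱ.mono (by omega))).measurable
      have h2 : Measurable[ℱ q] (r (s + 1)) :=
        ((hB.reward_measurable s hsT).mono (ℱ.mono (by omega))).measurable
      have h3 : Measurable[ℱ q] fun ω => (inner ℝ (a s ω) u : ℝ) := h1.inner_const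
      have h4 : Measurable[ℱ q] fun ω => (inner ℝ (a s ω) (θ s) : ℝ) := h1.inner_const
      exact (h3.mul (h2.sub (hμ.measurable.comp h4))).sub
        ((hμ'.measurable.comp h4).mul (h3.pow_const 2))
    · filter_upwards [hB.norm_action_le, hB.action_mem] with ω h1 h2
      have h3 := h1 q hqT _ (h2 q hqT)
      calc |inner ℝ (a q ω) u| ≤ ‖a q ω‖ * ‖u‖ := abs_real_inner_le_norm _ _
        _ ≤ 1 * (1 / m) := by gcongr
        _ = 1 / m := one_mul _

end IsBandit

end Bandit


/-! ### Mixtures over a truncated Gaussian. -/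

section Mixture

open Metric Matrix

variable {d : ℕ}

lemma lintegral_comp_linearMap {L : Vec d →ₗ[ℝ] Vec d} (hL : LinearMap.det L ≠ 0)
    {g : Vec d → ENNReal} (hg : Measurable g) :
    ∫⁻ y, g (L y) = ENNReal.ofReal |(LinearMap.det L)⁻¹| * ∫⁻ w, g w := by
  have hLm : Measurable L := (LinearMap.continuous_of_finiteDimensional L).measurable
  rw [← lintegral_map hg hLm, Measure.map_linearMap_addHaar_eq_smul_addHaar _ hL,
    lintegral_smul_measure, smul_eq_mul]

/-- The integral of `exp ∘ φ` over the centred ball of radius `R`. -/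
noncomputable def ballExp (R : ℝ) (φ : Vec d → ℝ) : ENNReal :=
  ∫⁻ u in closedBall 0 R, ENNReal.ofReal (Real.exp (φ u))

lemma ballExp_eq_indicator (R : ℝ) (φ : Vec d → ℝ) :
    ballExp R φ = ∫⁻ u, (closedBall 0 R).indicator
      (fun u => ENNReal.ofReal (Real.exp (φ u))) u := by
  rw [ballExp, lintegral_indicator measurableSet_closedBall]

lemma ballExp_mono {R : ℝ} {φ ψ : Vec d → ℝ} (h : ∀ u, φ u ≤ ψ u) : ballExp R φ ≤ ballExp R ψ :=
  lintegral_mono fun u => ENNReal.ofReal_le_ofReal (Real.exp_le_exp.2 (h u))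

lemma ballExp_pos {R : ℝ} (hR : 0 < R) {φ : Vec d → ℝ} (hφ : Measurable φ) : 0 < ballExp R φ := by
  rw [ballExp, setLIntegral_pos_iff (by fun_prop)]
  have : Function.support (fun u => ENNReal.ofReal (Real.exp (φ u))) = Set.univ := by
    ext u
    simp [Real.exp_pos]
  rw [this, Set.univ_inter]
  exact measure_closedBall_pos _ _ hR

lemma ballExp_ne_top {R : ℝ} {φ : Vec d → ℝ} (hφ : ∀ u, φ u ≤ 0) : ballExp R φ ≠ ⊤ := by
  refine ne_top_of_le_ne_top (b := ballExp R (fun _ : Vec d => 0)) ?_ (ballExp_mono hφ)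
  simp [ballExp, measure_closedBall_lt_top.ne]

/-- Rescaling by `√l / 2` rather than `√l` brings the integral to the radius `√l R / 2`, the one
reached by `sqrt_det_mul_gaussian_ballExp_le` from radius `R / 2`. The extra factor `2 ^ d` is the
source of the `d log 2` in `rho`. -/
lemma gaussian_ballExp_le (R : ℝ) {l : ℝ} (hl : 0 < l) :
    ballExp R (fun u : Vec d => -(l * ‖u‖ ^ 2))
      ≤ ENNReal.ofReal ((2 / √l) ^ d) * ballExp (√l * R / 2) (fun w : Vec d => -‖w‖ ^ 2) := by
  have hs : 0 < √l := Real.sqrt_pos.2 hl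
  set L : Vec d →ₗ[ℝ] Vec d := (√l / 2) • LinearMap.id with hLdef
  have hdet : LinearMap.det L = (√l / 2) ^ d := by
    rw [hLdef, LinearMap.det_smul, LinearMap.det_id, mul_one, finrank_euclideanSpace_fin]
  have hnorm : ∀ u, ‖L u‖ = √l / 2 * ‖u‖ := fun u => by
    simp [hLdef, norm_smul, abs_of_pos hs]
  have hg : Measurable ((closedBall (0 : Vec d) (√l * R / 2)).indicator
      fun w => ENNReal.ofReal (Real.exp (-(4 * ‖w‖ ^ 2)))) :=
    Measurable.indicator (by fun_prop) measurableSet_closedBall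
  have key := lintegral_comp_linearMap (L := L) (by rw [hdet]; positivity) hg
  have e : ∀ u, (closedBall (0 : Vec d) (√l * R / 2)).indicator
      (fun w => ENNReal.ofReal (Real.exp (-(4 * ‖w‖ ^ 2)))) (L u)
      = (closedBall (0 : Vec d) R).indicator
        (fun u => ENNReal.ofReal (Real.exp (-(l * ‖u‖ ^ 2)))) u := by
    intro u
    have hmem : L u ∈ closedBall (0 : Vec d) (√l * R / 2) ↔ u ∈ closedBall (0 : Vec d) R := by
      rw [mem_closedBall_zero_iff, mem_closedBall_zero_iff, hnorm]
      constructor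
      · intro h
        by_contra! h'
        nlinarith
      · intro h
        nlinarith
    have hq : 4 * ‖L u‖ ^ 2 = l * ‖u‖ ^ 2 := by
      rw [hnorm, mul_pow, div_pow, Real.sq_sqrt hl.le]
      ring
    by_cases hu : u ∈ closedBall (0 : Vec d) R
    · rw [Set.indicator_of_mem hu, Set.indicator_of_mem (hmem.2 hu), hq]
    · rw [Set.indicator_of_notMem hu, Set.indicator_of_notMem (fun h => hu (hmem.1 h))]
  simp_rw [e] at key
  rw [← ballExp_eq_indicator, ← ballExp_eq_indicator (d := d), hdet] at key
  rw [key, ← inv_pow, inv_div, abs_of_pos (by positivity)]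
  gcongr
  refine ballExp_mono fun u => ?_
  nlinarith [sq_nonneg ‖u‖]

/-- Factor the Gram matrix as `Bᵀ B` and substitute `w = B u`. Since the form dominates `l ‖u‖ ^ 2`,
the preimage of the ball of radius `√l R` lies in the ball of radius `R`. -/
lemma sqrt_det_mul_gaussian_ballExp_le {W : Finset ℕ} {c : ℕ → ℝ} (hc : ∀ s ∈ W, 0 ≤ c s)
    (x : ℕ → Vec d) {l : ℝ} (hl : 0 < l) (R : ℝ) :
    ballExp (√l * R) (fun w : Vec d => -‖w‖ ^ 2)
      ≤ ENNReal.ofReal (√(weightedGram W c x l).det)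
        * ballExp R (fun u => -gramForm W c x l u) := by
  have hpd := weightedGram_posDef hc x hl
  have hs : 0 < √l := Real.sqrt_pos.2 hl
  obtain ⟨B, hB⟩ := exists_factor_of_posSemidef hpd.posSemidef
  have hdetB : B.det ^ 2 = (weightedGram W c x l).det := by
    rw [hB, det_mul, det_transpose, pow_two]
  have hB0 : B.det ≠ 0 := fun h => hpd.det_pos.ne' (by rw [← hdetB, h]; simp)
  set L : Vec d →ₗ[ℝ] Vec d := toLpLin 2 2 B with hL
  have hdet : LinearMap.det L = B.det := by
    rw [hL, toLpLin_eq_toLin, LinearMap.det_toLin]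
  have hnorm : ∀ u, ‖L u‖ ^ 2 = gramForm W c x l u := fun u => by
    rw [← dotProduct_weightedGram, ← real_inner_self_eq_norm_sq, inner_eq_dotProduct, hL,
      ofLp_toLpLin, toLin'_apply, hB, ← mulVec_mulVec, dotProduct_mulVec u.ofLp, vecMul_transpose]
  have hg : Measurable ((closedBall (0 : Vec d) (√l * R)).indicator
      fun w => ENNReal.ofReal (Real.exp (-‖w‖ ^ 2))) :=
    Measurable.indicator (by fun_prop) measurableSet_closedBall
  have key := lintegral_comp_linearMap (L := L) (by rwa [hdet]) hg
  rw [← ballExp_eq_indicator, hdet] at key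
  have habs : |B.det| = √(weightedGram W c x l).det := by rw [← hdetB, Real.sqrt_sq_eq_abs]
  have hle : ∫⁻ y, (closedBall (0 : Vec d) (√l * R)).indicator
      (fun w => ENNReal.ofReal (Real.exp (-‖w‖ ^ 2))) (L y)
      ≤ ballExp R (fun u => -gramForm W c x l u) := by
    rw [ballExp_eq_indicator]
    refine lintegral_mono fun u => ?_
    by_cases hu : L u ∈ closedBall (0 : Vec d) (√l * R)
    · have hu' : u ∈ closedBall (0 : Vec d) R := by
        rw [mem_closedBall_zero_iff] at hu ⊢
        have h1 := gramForm_ge hc x l u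
        rw [← hnorm] at h1
        by_contra! h
        have h2 : (√l * ‖u‖) ^ 2 ≤ ‖L u‖ ^ 2 := by rwa [mul_pow, Real.sq_sqrt hl.le]
        have h3 := (sq_le_sq₀ (by positivity) (norm_nonneg _)).1 h2
        nlinarith
      rw [Set.indicator_of_mem hu, Set.indicator_of_mem hu', hnorm]
    · rw [Set.indicator_of_notMem hu]
      exact zero_le
  calc ballExp (√l * R) (fun w : Vec d => -‖w‖ ^ 2)
      = ENNReal.ofReal |B.det| * (ENNReal.ofReal |B.det⁻¹|
          * ballExp (√l * R) (fun w : Vec d => -‖w‖ ^ 2)) := by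
        rw [← mul_assoc, ← ENNReal.ofReal_mul (abs_nonneg _), ← abs_mul, mul_inv_cancel₀ hB0,
          abs_one, ENNReal.ofReal_one, one_mul]
    _ ≤ _ := by
        rw [← key, habs]
        gcongr

/-- Adding an odd function to the exponent of an even density does not decrease its integral. -/
lemma ballExp_le_ballExp_add_odd (R : ℝ) {ψ ℓ : Vec d → ℝ} (hψ : ∀ u, ψ (-u) = ψ u)
    (hℓ : ∀ u, ℓ (-u) = -ℓ u) (hψm : Measurable ψ) (hℓm : Measurable ℓ) :
    ballExp R ψ ≤ ballExp R (fun u => ℓ u + ψ u) := by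
  have h1 : ballExp R (fun u => -ℓ u + ψ u) = ballExp R (fun u => ℓ u + ψ u) := by
    rw [ballExp_eq_indicator, ballExp_eq_indicator, ← lintegral_neg_eq_self]
    refine lintegral_congr fun u => ?_
    by_cases hu : u ∈ closedBall (0 : Vec d) R
    · have : -u ∈ closedBall (0 : Vec d) R := by simpa using hu
      rw [Set.indicator_of_mem hu, Set.indicator_of_mem this, hψ, hℓ, neg_neg]
    · have : -u ∉ closedBall (0 : Vec d) R := by simpa using hu
      rw [Set.indicator_of_notMem hu, Set.indicator_of_notMem this]
  have h2 : ballExp R ψ + ballExp R ψ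
      ≤ ballExp R (fun u => ℓ u + ψ u) + ballExp R (fun u => -ℓ u + ψ u) := by
    rw [ballExp, ballExp, ballExp, ← lintegral_add_left (by fun_prop),
      ← lintegral_add_left (by fun_prop)]
    refine lintegral_mono fun u => ?_
    rw [← ENNReal.ofReal_add (Real.exp_pos _).le (Real.exp_pos _).le,
      ← ENNReal.ofReal_add (Real.exp_pos _).le (Real.exp_pos _).le, Real.exp_add, Real.exp_add]
    refine ENNReal.ofReal_le_ofReal ?_
    -- Averaging over `u` and `-u` replaces `exp ℓ` by `cosh ℓ ≥ 1`.
    have h3 : 2 ≤ Real.exp (ℓ u) + Real.exp (-ℓ u) := by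
      linarith [Real.add_one_le_exp (ℓ u), Real.add_one_le_exp (-ℓ u)]
    nlinarith [Real.exp_pos (ψ u)]
  rw [h1, ← two_mul, ← two_mul] at h2
  exact (ENNReal.mul_le_mul_iff_right two_ne_zero ENNReal.ofNat_ne_top).1 h2

lemma gramForm_add (W : Finset ℕ) (c : ℕ → ℝ) (x : ℕ → Vec d) (l : ℝ) (u v : Vec d) :
    gramForm W c x l (u + v) = gramForm W c x l u + gramForm W c x l v
      + 2 * (∑ s ∈ W, c s * (inner ℝ (x s) u * inner ℝ (x s) v) + l * inner ℝ u v) := by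
  have h : ∀ s, c s * inner ℝ (x s) (u + v) ^ 2 = c s * inner ℝ (x s) u ^ 2
      + c s * inner ℝ (x s) v ^ 2 + 2 * (c s * (inner ℝ (x s) u * inner ℝ (x s) v)) := fun s => by
    rw [inner_add_right]; ring
  simp_rw [gramForm, h, Finset.sum_add_distrib, ← Finset.mul_sum, norm_add_sq_real]
  ring

lemma measurable_gramForm (W : Finset ℕ) (c : ℕ → ℝ) (x : ℕ → Vec d) (l : ℝ) :
    Measurable (gramForm W c x l) := by
  unfold gramForm
  refine (Finset.measurable_fun_sum _ fun s _ => ?_).add (by fun_prop)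
  exact ((measurable_id.const_inner).pow_const 2).const_mul _

/-- Recentre at `v`: the exponent becomes its value at `v`, minus the quadratic form, plus a linear
term, which is odd and can only increase the integral. So `v` need not be the maximizer; the ball of
radius `R / 2` about it stays inside the ball of radius `R`. -/
lemma exp_mul_ballExp_le (W : Finset ℕ) (c : ℕ → ℝ) (x : ℕ → Vec d) (l : ℝ) (z v : Vec d)
    {R : ℝ} (hv : ‖v‖ ≤ R / 2) :
    ENNReal.ofReal (Real.exp (inner ℝ z v - gramForm W c x l v))
        * ballExp (R / 2) (fun u => -gramForm W c x l u)
      ≤ ballExp R (fun u => inner ℝ z u - gramForm W c x l u) := by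
  set f : Vec d → ℝ := fun u => inner ℝ z u - gramForm W c x l u with hf
  set ℓ : Vec d → ℝ := fun u => inner ℝ z u
    - 2 * (∑ s ∈ W, c s * (inner ℝ (x s) u * inner ℝ (x s) v) + l * inner ℝ u v) with hℓ
  have hfm := measurable_gramForm W c x l
  have hin : ∀ w : Vec d, Measurable fun u : Vec d => (inner ℝ w u : ℝ) :=
    fun w => measurable_id.const_inner
  have hin' : ∀ w : Vec d, Measurable fun u : Vec d => (inner ℝ u w : ℝ) :=
    fun w => measurable_id.inner_const
  have hℓm : Measurable ℓ :=
    (hin z).sub (((Finset.measurable_fun_sum _ fun s _ =>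
      ((hin _).mul_const _).const_mul _).add ((hin' v).const_mul l)).const_mul 2)
  have hadd : ∀ u, f (u + v) = f v + (ℓ u + -gramForm W c x l u) := fun u => by
    simp only [hf, hℓ, gramForm_add, inner_add_right]
    ring
  have h1 := ballExp_le_ballExp_add_odd (R / 2) (ψ := fun u => -gramForm W c x l u) (ℓ := ℓ)
    (fun u => by simp [gramForm]) (fun u => by simp [hℓ]; ring) hfm.neg hℓm
  calc _ ≤ ENNReal.ofReal (Real.exp (f v))
        * ballExp (R / 2) (fun u => ℓ u + -gramForm W c x l u) := by gcongr
    _ = ballExp (R / 2) (fun u => f (u + v)) := by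
        rw [ballExp, ballExp, ← lintegral_const_mul _ (by fun_prop)]
        refine lintegral_congr fun u => ?_
        rw [hadd, ← ENNReal.ofReal_mul (Real.exp_pos _).le, ← Real.exp_add]
    _ ≤ ballExp R f := by
        rw [ballExp_eq_indicator R, ← lintegral_add_right_eq_self _ v, ballExp_eq_indicator]
        refine lintegral_mono fun u => ?_
        by_cases hu : u ∈ closedBall (0 : Vec d) (R / 2)
        · have hu' : u + v ∈ closedBall (0 : Vec d) R := by
            rw [mem_closedBall_zero_iff] at hu ⊢
            have := norm_add_le u v
            linarith
          rw [Set.indicator_of_mem hu, Set.indicator_of_mem hu']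
        · rw [Set.indicator_of_notMem hu]
          exact zero_le

/-- Control of an exponent `⟪z, v⟫ - Q v` by the mixture of its exponential against a truncated
Gaussian. -/
lemma sub_gramForm_le_of_mixture (hd : 1 ≤ d) {W : Finset ℕ} {c : ℕ → ℝ} {x : ℕ → Vec d}
    {l K R C : ℝ} (hl : 0 < l) (hC : 0 < C) (hc : ∀ s ∈ W, 0 ≤ c s)
    (hcK : ∀ s ∈ W, c s ≤ K) (hK : 0 ≤ K) (hx : ∀ s ∈ W, ‖x s‖ ≤ 1) {z v : Vec d}
    (hv : ‖v‖ ≤ R / 2)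
    (h : ballExp R (fun u => inner ℝ z u - gramForm W c x l u)
      < ENNReal.ofReal C * ballExp R (fun u : Vec d => -(l * ‖u‖ ^ 2))) :
    inner ℝ z v - gramForm W c x l v
      ≤ Real.log C + d * Real.log 2 + d / 2 * Real.log (1 + K * W.card / (d * l)) := by
  have hs : 0 < √l := Real.sqrt_pos.2 hl
  have hd0 : (0 : ℝ) < d := by exact_mod_cast hd
  have hdet := (weightedGram_posDef hc x hl).det_pos
  have h1 := (exp_mul_ballExp_le W c x l z v hv).trans_lt h
  have h2 := (gaussian_ballExp_le (d := d) R hl)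
  have h3 := sqrt_det_mul_gaussian_ballExp_le hc x hl (R / 2)
  rw [mul_div_assoc'] at h3
  have h4 : ENNReal.ofReal (Real.exp (inner ℝ z v - gramForm W c x l v))
        * ballExp (R / 2) (fun u => -gramForm W c x l u)
      < ENNReal.ofReal (C * ((2 / √l) ^ d * √(weightedGram W c x l).det))
        * ballExp (R / 2) (fun u => -gramForm W c x l u) := by
    refine h1.trans_le ?_
    rw [ENNReal.ofReal_mul hC.le, ENNReal.ofReal_mul (by positivity), mul_assoc, mul_assoc]
    gcongr
    exact h2.trans (by gcongr)
  -- The truncated integral on both sides is the same, so it cancels and its value is never needed.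
  have h5 := lt_of_mul_lt_mul_right' h4
  rw [ENNReal.ofReal_lt_ofReal_iff (by positivity)] at h5
  have h6 := (Real.lt_log_iff_exp_lt (by positivity)).2 h5
  refine h6.le.trans ?_
  have h7 := Real.log_le_log hdet (weightedGram_det_le hd hl hc hcK hx)
  rw [Real.log_mul (by positivity) (by positivity), Real.log_pow, Real.log_pow] at h7
  rw [Real.log_mul hC.ne' (by positivity), Real.log_mul (by positivity) (by positivity),
    Real.log_pow, Real.log_div (by norm_num) hs.ne', Real.log_sqrt hl.le, Real.log_sqrt hdet.le]
  linarith

end Mixture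


/-! ### High-probability bound on the score over the window. -/

section Concentration

variable {d : ℕ} {Ω : Type*} [MeasurableSpace Ω] {F : ExpFamily} {P : Measure Ω}
  {ℱ : Filtration ℕ ‹MeasurableSpace Ω›} {T : ℕ} {S m kμ : ℝ} {θ : ℕ → Vec d}
  {A : ℕ → Ω → Set (Vec d)} {a : ℕ → Ω → Vec d} {r : ℕ → Ω → ℝ}

lemma mem_window {τ t s : ℕ} : s ∈ window τ t ↔ 1 ≤ s ∧ t ≤ s + τ ∧ s < t := by
  simp [window]
  omega

lemma mem_Icc_of_mem_window {τ t s T : ℕ} (ht : t ∈ Finset.Icc 1 T) (hs : s ∈ window τ t) :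
    s ∈ Finset.Icc 1 T := by
  rw [mem_window] at hs
  simp at ht ⊢
  omega

lemma card_window_le {τ t : ℕ} : (window τ t).card ≤ min t τ := by
  simp [window]
  omega

/-- The conditional variances `μ'(a sᵀ θ s)` of the rewards. -/
noncomputable def condVar (F : ExpFamily) (θ : ℕ → Vec d) (a : ℕ → Vec d) (s : ℕ) : ℝ :=
  deriv F.mean (inner ℝ (a s) (θ s))

/-- In all directions, the score over the window at time `t` is at most `ρ_t^δ` in the norm
dual to that of the regularized Fisher information. -/
def ScoreBound (F : ExpFamily) (T τ : ℕ) (lam m kμ δ : ℝ) (θ : ℕ → Vec d) (a : ℕ → Vec d)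
    (r : ℕ → ℝ) (t : ℕ) : Prop :=
  ∀ v : Vec d, inner ℝ (score F (window τ t) θ a r) v
    ≤ rho d T τ lam m kμ δ t * √(gramForm (window τ t) (condVar F θ a) a lam v)

lemma scoreBound_of_mixture (hd : 1 ≤ d) (hT : 1 ≤ T) {τ t : ℕ} {lam δ : ℝ} (hlam : 0 < lam)
    (hm : 0 < m) (hδ : 0 < δ) (hS : 0 ≤ S) (hF : F.LinkAssumptions d S kμ) {a : ℕ → Vec d}
    {r : ℕ → ℝ} (ha : ∀ s ∈ window τ t, ‖a s‖ ≤ 1)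
    (h : ballExp (1 / m) (fun u => inner ℝ (score F (window τ t) θ a r) u
        - gramForm (window τ t) (condVar F θ a) a lam u)
      < ENNReal.ofReal (T / δ) * ballExp (1 / m) (fun u : Vec d => -(lam * ‖u‖ ^ 2))) :
    ScoreBound F T τ lam m kμ δ θ a r t := by
  intro v
  rcases eq_or_ne v 0 with rfl | hv
  · simp [gramForm]
  have hd0 : (0 : ℝ) < d := by exact_mod_cast hd
  have hT0 : (0 : ℝ) < T := by exact_mod_cast hT
  have hk := hF.lipschitz_pos hS
  have hc : ∀ s ∈ window τ t, 0 ≤ condVar F θ a s := fun s _ => hF.deriv_mean_nonneg _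
  have hcK : ∀ s ∈ window τ t, condVar F θ a s ≤ kμ := fun s _ => hF.deriv_mean_le _
  set W := window τ t with hW
  set z := score F W θ a r with hz
  set q := √(gramForm W (condVar F θ a) a lam v) with hq
  have hge := gramForm_ge hc a lam v
  have hvpos : 0 < ‖v‖ := norm_pos_iff.2 hv
  have hQ : 0 < gramForm W (condVar F θ a) a lam v := lt_of_lt_of_le (by positivity) hge
  have hq0 : 0 < q := Real.sqrt_pos.2 hQ
  have hs : 0 < √lam := Real.sqrt_pos.2 hlam
  -- The direction is rescaled to Fisher norm `γ`. As `√lam ‖v‖ ≤ q`, this keeps it in the half ball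
  -- of radius `1 / (2 m)`; dividing the resulting inequality by `γ` produces exactly `rho`.
  set γ := √lam / (2 * m) with hγ
  have hγ0 : 0 < γ := by positivity
  have hqv : √lam * ‖v‖ ≤ q := by
    rw [hq]
    refine Real.le_sqrt_of_sq_le ?_
    rwa [mul_pow, Real.sq_sqrt hlam.le]
  have hu : ‖(γ / q) • v‖ ≤ 1 / m / 2 := by
    rw [norm_smul, Real.norm_of_nonneg (by positivity), div_mul_eq_mul_div, div_le_iff₀ hq0, hγ]
    calc √lam / (2 * m) * ‖v‖ = 1 / m / 2 * (√lam * ‖v‖) := by field_simp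
      _ ≤ 1 / m / 2 * q := by gcongr
  have key := sub_gramForm_le_of_mixture hd hlam (div_pos hT0 hδ) hc hcK hk.le ha hu h
  have hg : gramForm W (condVar F θ a) a lam ((γ / q) • v) = γ ^ 2 := by
    have : gramForm W (condVar F θ a) a lam ((γ / q) • v)
        = (γ / q) ^ 2 * gramForm W (condVar F θ a) a lam v := by
      simp only [gramForm, real_inner_smul_right, norm_smul, mul_add, Finset.mul_sum, mul_pow,
        Real.norm_eq_abs, sq_abs]
      congr 1
      · exact Finset.sum_congr rfl fun s _ => by ring
      · ring
    rw [this, ← Real.sq_sqrt hQ.le, ← hq]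
    field_simp
  rw [hg, real_inner_smul_right] at key
  have hcard : Real.log (1 + kμ * W.card / (d * lam))
      ≤ Real.log (1 + kμ * (min t τ : ℕ) / (d * lam)) := by
    have h1 : (W.card : ℝ) ≤ (min t τ : ℕ) := by exact_mod_cast card_window_le
    refine Real.log_le_log (by positivity) ?_
    gcongr
  have hfin : γ / q * inner ℝ z v ≤ γ * rho d T τ lam m kμ δ t := by
    have e : γ * rho d T τ lam m kμ δ t = γ ^ 2 + (Real.log (T / δ) + d * Real.log 2
        + d / 2 * Real.log (1 + kμ * (min t τ : ℕ) / (d * lam))) := by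
      rw [rho, hγ]
      field_simp
      ring
    rw [e]
    have := mul_le_mul_of_nonneg_left hcard (by positivity : (0 : ℝ) ≤ d / 2)
    linarith
  have h2 : γ * (inner ℝ z v / q) ≤ γ * rho d T τ lam m kμ δ t := by
    calc _ = γ / q * inner ℝ z v := by ring
      _ ≤ _ := hfin
  have h3 := le_of_mul_le_mul_left h2 hγ0
  rwa [div_le_iff₀ hq0] at h3

lemma score_sub_gramForm_eq (W : Finset ℕ) (lam : ℝ) (a : ℕ → Vec d) (r : ℕ → ℝ) (u : Vec d) :
    inner ℝ (score F W θ a r) u - gramForm W (condVar F θ a) a lam u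
      = ∑ s ∈ W, (inner ℝ (a s) u * (r (s + 1) - F.mean (inner ℝ (a s) (θ s)))
        - deriv F.mean (inner ℝ (a s) (θ s)) * inner ℝ (a s) u ^ 2) + -(lam * ‖u‖ ^ 2) := by
  rw [inner_score, gramForm, Finset.sum_sub_distrib]
  simp only [condVar]
  ring

/-- By Tonelli the mixture has expectation at most the Gaussian normalization `N`, and Markov's
inequality at level `T / δ` applies. -/
lemma IsBandit.measure_not_scoreBound_le [IsProbabilityMeasure P]
    (hB : IsBandit F P ℱ T S m θ A a r) (hd : 1 ≤ d) {τ t : ℕ} (ht : t ∈ Finset.Icc 1 T)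
    {lam δ : ℝ} (hlam : 0 < lam) (hm : 0 < m) (hδ : 0 < δ) (hS : 0 ≤ S)
    (hF : F.LinkAssumptions d S kμ) :
    P {ω | ¬ ScoreBound F T τ lam m kμ δ θ (fun s => a s ω) (fun s => r s ω) t}
      ≤ ENNReal.ofReal (δ / T) := by
  have ht' : 1 ≤ t ∧ t ≤ T := by simpa using ht
  have hT : 1 ≤ T := ht'.1.trans ht'.2
  have hT0 : (0 : ℝ) < T := by exact_mod_cast hT
  have hμ : Continuous F.mean := hF.differentiable_mean.continuous
  have hμ' : Continuous (deriv F.mean) := hF.differentiable_deriv.continuous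
  set ψ : Ω → Vec d → ℝ := fun ω u => ∑ s ∈ window τ t,
    (inner ℝ (a s ω) u * (r (s + 1) ω - F.mean (inner ℝ (a s ω) (θ s)))
      - deriv F.mean (inner ℝ (a s ω) (θ s)) * inner ℝ (a s ω) u ^ 2) with hψ
  set f : Ω → ENNReal := fun ω => ballExp (1 / m) (fun u => ψ ω u + -(lam * ‖u‖ ^ 2)) with hf
  set N := ballExp (1 / m) (fun u : Vec d => -(lam * ‖u‖ ^ 2)) with hN
  have hN0 : N ≠ 0 := (ballExp_pos (by positivity) (by fun_prop)).ne'
  have hNtop : N ≠ ⊤ := ballExp_ne_top fun u => by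
    have : 0 ≤ lam * ‖u‖ ^ 2 := by positivity
    linarith
  have hψm : Measurable fun p : Ω × Vec d => ψ p.1 p.2 := by
    refine Finset.measurable_fun_sum _ fun s hs => ?_
    have hsT := mem_Icc_of_mem_window ht hs
    have h1 : Measurable fun p : Ω × Vec d => a s p.1 :=
      (hB.measurable_action hsT).comp measurable_fst
    have h2 : Measurable fun p : Ω × Vec d => r (s + 1) p.1 :=
      (hB.measurable_reward hsT).comp measurable_fst
    have h3 : Measurable fun p : Ω × Vec d => (inner ℝ (a s p.1) p.2 : ℝ) :=
      h1.inner measurable_snd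
    have h4 : Measurable fun p : Ω × Vec d => (inner ℝ (a s p.1) (θ s) : ℝ) := h1.inner_const
    exact (h3.mul (h2.sub (hμ.measurable.comp h4))).sub
      ((hμ'.measurable.comp h4).mul (h3.pow_const 2))
  have hem : Measurable fun p : Ω × Vec d =>
      ENNReal.ofReal (Real.exp (ψ p.1 p.2 + -(lam * ‖p.2‖ ^ 2))) :=
    ENNReal.measurable_ofReal.comp (Real.measurable_exp.comp (hψm.add (by fun_prop)))
  have hfm : Measurable f := Measurable.lintegral_prod_right' hem
  have hint : ∫⁻ ω, f ω ∂P ≤ N := by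
    simp only [hf, ballExp]
    rw [lintegral_lintegral_swap hem.aemeasurable, hN, ballExp]
    refine setLIntegral_mono' Metric.isClosed_closedBall.measurableSet fun u hu => ?_
    have hu' : ‖u‖ ≤ 1 / m := by simpa using hu
    simp_rw [Real.exp_add, ENNReal.ofReal_mul (Real.exp_pos _).le]
    rw [lintegral_mul_const' _ _ ENNReal.ofReal_ne_top]
    refine mul_le_of_le_one_left' ?_
    exact hB.lintegral_exp_score_le_one hT hm hF u hu' (le_max_left _ _)
      (by omega) (by omega)
  have hmarkov := (mul_meas_ge_le_lintegral hfm (ENNReal.ofReal (T / δ) * N) (μ := P)).trans hint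
  have hle : P {ω | ENNReal.ofReal (T / δ) * N ≤ f ω} ≤ ENNReal.ofReal (δ / T) := by
    have h1 : N * (ENNReal.ofReal (T / δ) * P {ω | ENNReal.ofReal (T / δ) * N ≤ f ω})
        ≤ N * 1 := by
      rw [mul_one]
      refine le_trans (le_of_eq ?_) hmarkov
      ring
    have h2 := (ENNReal.mul_le_mul_iff_right hN0 hNtop).1 h1
    calc _ = ENNReal.ofReal (δ / T) * (ENNReal.ofReal (T / δ)
          * P {ω | ENNReal.ofReal (T / δ) * N ≤ f ω}) := by
          rw [← mul_assoc, ← ENNReal.ofReal_mul (by positivity)]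
          rw [show δ / T * (T / δ) = 1 by field_simp, ENNReal.ofReal_one, one_mul]
      _ ≤ ENNReal.ofReal (δ / T) * 1 := by gcongr
      _ = _ := mul_one _
  refine le_trans (measure_mono_ae ?_) hle
  filter_upwards [hB.norm_action_le, hB.action_mem] with ω h1 h2 hω
  by_contra hlt
  refine hω (scoreBound_of_mixture hd hT hlam hm hδ hS hF (fun s hs => ?_) ?_)
  · have hsT := mem_Icc_of_mem_window ht hs
    exact h1 s hsT _ (h2 s hsT)
  · simp_rw [score_sub_gramForm_eq]
    exact not_le.1 hlt

lemma IsBandit.measure_forall_scoreBound_ge [IsProbabilityMeasure P]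
    (hB : IsBandit F P ℱ T S m θ A a r) (hd : 1 ≤ d) (hT : 1 ≤ T) {τ : ℕ}
    {lam δ : ℝ} (hlam : 0 < lam) (hm : 0 < m) (hδ : 0 < δ) (hS : 0 ≤ S)
    (hF : F.LinkAssumptions d S kμ) :
    ENNReal.ofReal (1 - δ) ≤ P {ω | ∀ t ∈ Finset.Icc 1 T,
      ScoreBound F T τ lam m kμ δ θ (fun s => a s ω) (fun s => r s ω) t} := by
  have hT0 : (0 : ℝ) < T := by exact_mod_cast hT
  set G := {ω | ∀ t ∈ Finset.Icc 1 T,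
      ScoreBound F T τ lam m kμ δ θ (fun s => a s ω) (fun s => r s ω) t} with hG
  have hc : Gᶜ = ⋃ t ∈ Finset.Icc 1 T,
      {ω | ¬ ScoreBound F T τ lam m kμ δ θ (fun s => a s ω) (fun s => r s ω) t} := by
    ext ω
    simp [hG, and_assoc]
  have h1 : P Gᶜ ≤ ENNReal.ofReal δ := by
    rw [hc]
    refine (measure_biUnion_finset_le _ _).trans ?_
    calc _ ≤ ∑ t ∈ Finset.Icc 1 T, ENNReal.ofReal (δ / T) := Finset.sum_le_sum fun t ht =>
          hB.measure_not_scoreBound_le hd ht hlam hm hδ hS hF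
      _ = ENNReal.ofReal δ := by
          rw [Finset.sum_const, Nat.card_Icc, Nat.add_sub_cancel, nsmul_eq_mul,
            ← ENNReal.ofReal_natCast, ← ENNReal.ofReal_mul hT0.le]
          congr 1
          field_simp
  -- Subadditivity suffices here, so the measurability of `G`, a condition over all directions, is
  -- not needed.
  have h2 : 1 ≤ P G + P Gᶜ := by
    rw [← measure_univ (μ := P), ← Set.union_compl_self G]
    exact measure_union_le _ _
  rw [ENNReal.ofReal_sub _ hδ.le, ENNReal.ofReal_one, tsub_le_iff_right]
  exact h2.trans (by gcongr)

end Concentration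


/-! ### From the score bound to the prediction error. -/

section Estimation

variable {d : ℕ} {F : ExpFamily} {T τ t : ℕ} {lam S m kμ δ : ℝ}

/-- The first-order condition of the penalized likelihood. -/
lemma score_equation (hF : Differentiable ℝ F.b) {a : ℕ → Vec d} {r : ℕ → ℝ} {θh : Vec d}
    (h : IsMaxOn (penLogLik F lam τ t a r) Set.univ θh) (v : Vec d) :
    ∑ s ∈ window τ t, (r (s + 1) - F.mean (inner ℝ (a s) θh)) * inner ℝ (a s) v
      = lam * inner ℝ θh v := by
  set φ : ℝ → ℝ := fun x => penLogLik F lam τ t a r (θh + x • v) with hφ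
  have hmax : IsLocalMax φ 0 := Filter.Eventually.of_forall fun x => by
    simpa [hφ] using h (Set.mem_univ (θh + x • v))
  have hlin : ∀ s, HasDerivAt (fun x : ℝ => inner ℝ (a s) (θh + x • v)) (inner ℝ (a s) v) 0 := by
    intro s
    simp only [inner_add_right, real_inner_smul_right]
    simpa using ((hasDerivAt_id (0 : ℝ)).mul_const (inner ℝ (a s) v)).const_add
      (inner ℝ (a s) θh)
  have hlog : ∀ s, HasDerivAt
      (fun x : ℝ => F.logDensity (inner ℝ (a s) (θh + x • v)) (r (s + 1)))
      ((r (s + 1) - F.mean (inner ℝ (a s) θh)) * inner ℝ (a s) v) 0 := by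
    intro s
    have hb : HasDerivAt F.b (F.mean (inner ℝ (a s) (θh + (0 : ℝ) • v)))
        (inner ℝ (a s) (θh + (0 : ℝ) • v)) := (hF _).hasDerivAt
    have h1 := (((hlin s).const_mul (r (s + 1))).sub (hb.comp 0 (hlin s))).add_const
      (F.c (r (s + 1)))
    refine h1.congr_deriv ?_
    simp
    ring
  have hnorm : HasDerivAt (fun x : ℝ => lam / 2 * ‖θh + x • v‖ ^ 2) (lam * inner ℝ θh v) 0 := by
    have e : (fun x : ℝ => lam / 2 * ‖θh + x • v‖ ^ 2)
        = fun x => lam / 2 * (‖θh‖ ^ 2 + 2 * (x * inner ℝ θh v) + x ^ 2 * ‖v‖ ^ 2) := by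
      ext x
      rw [norm_add_sq_real, real_inner_smul_right, norm_smul, mul_pow, Real.norm_eq_abs, sq_abs]
    rw [e]
    have h1 := (((((hasDerivAt_id (0 : ℝ)).mul_const (inner ℝ θh v)).const_mul 2).const_add
      (‖θh‖ ^ 2)).add (((hasDerivAt_id (0 : ℝ)).pow 2).mul_const (‖v‖ ^ 2))).const_mul (lam / 2)
    refine h1.congr_deriv ?_
    simp
    ring
  have hderiv := (HasDerivAt.fun_sum fun s (_ : s ∈ window τ t) => hlog s).sub hnorm
  have := hmax.hasDerivAt_eq_zero hderiv
  linarith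

lemma rho_nonneg (hT : 1 ≤ T) (hlam : 0 < lam) (hm : 0 < m) (hk : 0 < kμ) (hδ : 0 < δ)
    (hδ1 : δ ≤ 1) (t : ℕ) : 0 ≤ rho d T τ lam m kμ δ t := by
  have hT1 : (1 : ℝ) ≤ T := by exact_mod_cast hT
  have h1 : 0 ≤ Real.log (T / δ) := Real.log_nonneg (by rw [le_div_iff₀ hδ]; linarith)
  have h2 : 0 ≤ Real.log (1 + kμ * (min t τ : ℕ) / (d * lam)) :=
    Real.log_nonneg (le_add_of_nonneg_right (by positivity))
  unfold rho
  positivity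

lemma rho_mono (hlam : 0 < lam) (hm : 0 < m) (hk : 0 < kμ) (htT : t ≤ T) :
    rho d T τ lam m kμ δ t ≤ rho d T τ lam m kμ δ T := by
  unfold rho
  gcongr

lemma beta_mono (hT : 1 ≤ T) (hlam : 0 < lam) (hm : 0 < m) (hk : 0 < kμ) (hδ : 0 < δ)
    (hδ1 : δ ≤ 1) (hS : 0 ≤ S) (htT : t ≤ T) :
    beta d T τ lam S m kμ δ t ≤ beta d T τ lam S m kμ δ T := by
  have h0 := rho_nonneg (d := d) (τ := τ) hT hlam hm hk hδ hδ1 t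
  have h1 := rho_mono (d := d) (τ := τ) (δ := δ) hlam hm hk htT
  unfold beta
  gcongr

lemma beta_nonneg (hT : 1 ≤ T) (hlam : 0 < lam) (hm : 0 < m) (hk : 0 < kμ) (hδ : 0 < δ)
    (hδ1 : δ ≤ 1) (hS : 0 ≤ S) (t : ℕ) : 0 ≤ beta d T τ lam S m kμ δ t := by
  have h0 := rho_nonneg (d := d) (τ := τ) hT hlam hm hk hδ hδ1 t
  unfold beta
  positivity

lemma le_of_sq_le_add_mul {y κ s : ℝ} (hκ : 0 ≤ κ) (hs : 0 ≤ s)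
    (h : y ^ 2 ≤ s + κ * y) : y ≤ κ + √s := by
  by_contra! hlt
  have h1 := Real.sqrt_nonneg s
  have h2 := Real.sq_sqrt hs
  nlinarith

lemma designMatrix_eq (lam c : ℝ) (τ t : ℕ) (a : ℕ → Vec d) :
    designMatrix lam c τ t a = weightedGram (window τ t) (fun _ => 1) a (lam / c) := by
  simp [designMatrix, weightedGram]

lemma sq_matNorm_inv {M : Matrix (Fin d) (Fin d) ℝ} (hM : M.PosDef) (x : Vec d) :
    matNorm M⁻¹ x ^ 2 = x.ofLp ⬝ᵥ M⁻¹.mulVec x.ofLp :=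
  Real.sq_sqrt (inv_form_nonneg hM _)

lemma abs_inner_le_matNorm_inv {M : Matrix (Fin d) (Fin d) ℝ} (hM : M.PosDef) (x y : Vec d) :
    |inner ℝ x y| ≤ matNorm M⁻¹ x * matNorm M y := by
  rw [matNorm, matNorm, ← Real.sqrt_mul (inv_form_nonneg hM _)]
  refine Real.abs_le_sqrt ?_
  rw [inner_eq_dotProduct]
  exact dotProduct_sq_le_of_posDef hM _ _

/-- Under the score bound, and when the parameter is constant over the window, the estimation error
is controlled in the norm of the regularized Fisher information. -/
lemma sqrt_gramForm_sub_le (hT : 1 ≤ T) (hlam : 0 < lam) (hm : 0 < m) (hδ : 0 < δ) (hδ1 : δ ≤ 1)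
    (hS : 0 ≤ S) (hF : F.LinkAssumptions d S kμ) {θ : ℕ → Vec d} {a : ℕ → Vec d} {r : ℕ → ℝ}
    {θh : Vec d} (ha : ∀ s ∈ window τ t, ‖a s‖ ≤ 1) (hθ : ‖θ t‖ ≤ S)
    (hconst : ∀ s ∈ window τ t, θ s = θ t)
    (hmax : IsMaxOn (penLogLik F lam τ t a r) Set.univ θh)
    (hscore : ScoreBound F T τ lam m kμ δ θ a r t) :
    √(gramForm (window τ t) (condVar F θ a) a lam (θh - θ t))
      ≤ beta d T τ lam S m kμ δ t / kμ := by
  have hk := hF.lipschitz_pos hS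
  set c := condVar F θ a with hc
  set W := window τ t with hW
  set ρ := rho d T τ lam m kμ δ t with hρ
  have hρ0 : 0 ≤ ρ := rho_nonneg hT hlam hm hk hδ hδ1 t
  have hs : 0 < √lam := Real.sqrt_pos.2 hlam
  have hslam : √lam ^ 2 = lam := Real.sq_sqrt hlam.le
  set Δ := θh - θ t with hΔ
  set D := ‖Δ‖ with hD
  have hD0 : 0 ≤ D := norm_nonneg _
  set y := √(1 + D) with hy
  have hy0 : 0 < y := Real.sqrt_pos.2 (by linarith)
  have hy2 : y ^ 2 = 1 + D := Real.sq_sqrt (by linarith)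
  have hc0 : ∀ s ∈ W, 0 ≤ c s := fun s _ => hF.deriv_mean_nonneg _
  set Q := gramForm W c a lam Δ with hQ
  have hQ0 : 0 ≤ Q := le_trans (by positivity) (gramForm_ge hc0 a lam Δ)
  -- `G` pairs `Δ` with the difference of gradients of the penalized negative log-likelihood at `θh`
  -- and `θ t`. It equals a score term by `hGeq` and dominates the Fisher form `Q` up to `1 + D` by
  -- `hGQ`.
  set G := ∑ s ∈ W, (F.mean (inner ℝ (a s) θh) - F.mean (inner ℝ (a s) (θ t)))
    * inner ℝ (a s) Δ + lam * D ^ 2 with hG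
  have hθh : ∀ z : Vec d, inner ℝ z θh = inner ℝ z (θ t) + (inner ℝ z Δ : ℝ) := fun z => by
    rw [hΔ, inner_sub_right]; ring
  have hb : Differentiable ℝ F.b := F.contDiff_b.differentiable (by simp)
  have hGeq : G = inner ℝ (score F W θ a r) Δ - lam * inner ℝ (θ t) Δ := by
    have h1 := score_equation hb hmax Δ
    have h2 : inner ℝ θh Δ = inner ℝ (θ t) Δ + D ^ 2 := by
      rw [real_inner_comm Δ θh, hθh, real_inner_self_eq_norm_sq, real_inner_comm]
    have h3 : inner ℝ (score F W θ a r) Δ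
        = ∑ s ∈ W, (r (s + 1) - F.mean (inner ℝ (a s) θh)) * inner ℝ (a s) Δ
          + ∑ s ∈ W, (F.mean (inner ℝ (a s) θh) - F.mean (inner ℝ (a s) (θ t)))
            * inner ℝ (a s) Δ := by
      rw [inner_score, ← Finset.sum_add_distrib]
      refine Finset.sum_congr rfl fun s hsW => ?_
      rw [hconst s hsW]
      ring
    rw [h3, h1, h2, hG]
    ring
  have hterm : ∀ s ∈ W, c s * inner ℝ (a s) Δ ^ 2 / (1 + D)
      ≤ (F.mean (inner ℝ (a s) θh) - F.mean (inner ℝ (a s) (θ t))) * inner ℝ (a s) Δ := by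
    intro s hsW
    have h1 := selfConcordant_mul_sub_ge hF.differentiable_mean hF.differentiable_deriv
      hF.self_concordant (inner ℝ (a s) (θ t)) (inner ℝ (a s) Δ)
    rw [← hθh] at h1
    refine le_trans ?_ h1
    have h2 : |inner ℝ (a s) Δ| ≤ D := by
      calc |inner ℝ (a s) Δ| ≤ ‖a s‖ * ‖Δ‖ := abs_real_inner_le_norm _ _
        _ ≤ 1 * ‖Δ‖ := by gcongr; exact ha s hsW
        _ = D := one_mul _
    have h3 : c s = deriv F.mean (inner ℝ (a s) (θ t)) := by rw [hc, condVar, hconst s hsW]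
    rw [h3, mul_div_assoc]
    have := hF.deriv_mean_nonneg (inner ℝ (a s) (θ t))
    gcongr
  have hGQ : Q / (1 + D) ≤ G := by
    rw [hQ, gramForm, add_div, Finset.sum_div, hG]
    refine add_le_add (Finset.sum_le_sum hterm) (div_le_self (by positivity) (by linarith))
  have hG0 : 0 ≤ G := le_trans (by positivity) hGQ
  set q := √G with hq
  have hq0 : 0 ≤ q := Real.sqrt_nonneg _
  have hq2 : q ^ 2 = G := Real.sq_sqrt hG0
  have hDq : √lam * D ≤ q := by
    refine Real.le_sqrt_of_sq_le ?_
    rw [mul_pow, hslam, hG]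
    refine le_add_of_nonneg_left (Finset.sum_nonneg fun s hsW => le_trans ?_ (hterm s hsW))
    have := hc0 s hsW
    positivity
  have hQq : √Q ≤ y * q := by
    rw [Real.sqrt_le_left (by positivity), mul_pow, hy2, hq2]
    rwa [div_le_iff₀' (by linarith)] at hGQ
  -- The score term costs `ρ √Q ≤ ρ y q` and the bias of the penalty costs `√lam S q`; one factor
  -- `q` cancels.
  have hqle : q ≤ ρ * y + √lam * S := by
    have h1 := hscore Δ
    have h2 : -(lam * inner ℝ (θ t) Δ) ≤ lam * (S * D) := by
      have := (abs_le.1 (abs_real_inner_le_norm (θ t) Δ)).1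
      have h3 : ‖θ t‖ * ‖Δ‖ ≤ S * D := by gcongr
      nlinarith
    have h3 : q ^ 2 ≤ (ρ * y + √lam * S) * q := by
      calc q ^ 2 = G := hq2
        _ ≤ ρ * √Q + lam * (S * D) := by rw [hGeq]; linarith
        _ ≤ ρ * (y * q) + √lam * S * (√lam * D) := by
            refine add_le_add (by gcongr) (le_of_eq ?_)
            rw [← hslam]
            simp only [Real.sqrt_sq hs.le]
            ring
        _ ≤ ρ * (y * q) + √lam * S * q := by gcongr
        _ = _ := by ring
    rcases hq0.eq_or_lt with h0 | h0
    · rw [← h0]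
      positivity
    · rw [pow_two] at h3
      exact le_of_mul_le_mul_right h3 h0
  set κ := ρ / √lam with hκ
  have hκ0 : 0 ≤ κ := by positivity
  have hρκ : ρ = √lam * κ := by rw [hκ]; field_simp
  have hqle' : q ≤ √lam * (κ * y + S) := by
    refine hqle.trans (le_of_eq ?_)
    rw [hρκ]
    ring
  have hDle : D ≤ κ * y + S := le_of_mul_le_mul_left (hDq.trans hqle') hs
  -- The loop closes: `D ≤ κ y + S` reads `y ^ 2 ≤ 1 + S + κ y`, a quadratic inequality bounding `y`
  -- with no a priori bound on the estimator.
  have hyle : y ≤ κ + √(1 + S) :=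
    le_of_sq_le_add_mul hκ0 (by linarith) (by rw [hy2]; linarith)
  set B := 1 + S + √((1 + S) / lam) * ρ + κ ^ 2 with hB
  have hB0 : 0 < B := by positivity
  have hBκ : 1 + S + κ * y ≤ B := by
    have e : √((1 + S) / lam) * ρ = √(1 + S) * κ := by
      rw [Real.sqrt_div (by linarith), hκ]
      ring
    rw [hB, e]
    nlinarith
  have hyB : y ≤ √B := by
    refine Real.le_sqrt_of_sq_le ?_
    rw [hy2]
    linarith
  have hqB : q ≤ √lam * B := hqle'.trans (by gcongr; linarith)
  have hBpow : √B * B = B ^ (3 / 2 : ℝ) := by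
    rw [Real.sqrt_eq_rpow]
    nth_rewrite 2 [← Real.rpow_one B]
    rw [← Real.rpow_add hB0]
    norm_num
  have hfin : y * q ≤ √B * (√lam * B) := mul_le_mul hyB hqB hq0 (Real.sqrt_nonneg _)
  have e : beta d T τ lam S m kμ δ t / kμ = √B * (√lam * B) := by
    rw [beta, ← hρ, ← hκ, ← hB, ← hBpow]
    field_simp
  rw [e]
  exact hQq.trans hfin

/-- Under the score bound, the estimator predicts all rewards up to the exploration bonus, when
the parameter is constant over the window. -/
lemma abs_mean_sub_le (hT : 1 ≤ T) (hlam : 0 < lam) (hm : 0 < m) (hδ : 0 < δ) (hδ1 : δ ≤ 1)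
    (hS : 0 ≤ S) (hF : F.LinkAssumptions d S kμ) {θ : ℕ → Vec d} {a : ℕ → Vec d} {r : ℕ → ℝ}
    {θh : Vec d} (ha : ∀ s ∈ window τ t, ‖a s‖ ≤ 1) (hθ : ‖θ t‖ ≤ S)
    (hconst : ∀ s ∈ window τ t, θ s = θ t)
    (hmax : IsMaxOn (penLogLik F lam τ t a r) Set.univ θh)
    (hscore : ScoreBound F T τ lam m kμ δ θ a r t) (x : Vec d) :
    |F.mean (inner ℝ x θh) - F.mean (inner ℝ x (θ t))|
      ≤ beta d T τ lam S m kμ δ t / √(F.cmu d S)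
        * matNorm (designMatrix lam (F.cmu d S) τ t a)⁻¹ x := by
  have hk := hF.lipschitz_pos hS
  have hcμ := hF.cmu_pos
  have hQle := sqrt_gramForm_sub_le hT hlam hm hδ hδ1 hS hF ha hθ hconst hmax hscore
  set cμ := F.cmu d S with hcμdef
  set Δ := θh - θ t with hΔ
  set Q := gramForm (window τ t) (condVar F θ a) a lam Δ with hQ
  set N := matNorm (designMatrix lam cμ τ t a)⁻¹ x with hN
  have hN0 : 0 ≤ N := Real.sqrt_nonneg _
  have hQ0 : 0 ≤ Q := le_trans (by positivity)
    (gramForm_ge (fun s _ => hF.deriv_mean_nonneg _) a lam Δ)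
  have hpd : (designMatrix lam cμ τ t a).PosDef := by
    rw [designMatrix_eq]
    exact weightedGram_posDef (fun _ _ => zero_le_one) a (by positivity)
  -- The curvature is evaluated at the true parameter, where it is at least `cμ`; the regularization
  -- `lam / cμ` of the design matrix is the one matching `lam` in `Q`.
  have hV : matNorm (designMatrix lam cμ τ t a) Δ ≤ √Q / √cμ := by
    rw [matNorm, designMatrix_eq, dotProduct_weightedGram, ← Real.sqrt_div hQ0]
    refine Real.sqrt_le_sqrt ?_
    rw [hQ, gramForm, gramForm, add_div, Finset.sum_div]
    refine add_le_add (Finset.sum_le_sum fun s hsW => ?_) (le_of_eq (by ring))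
    rw [le_div_iff₀ hcμ, one_mul, mul_comm]
    have h1 : cμ ≤ condVar F θ a s := by
      rw [condVar, hconst s hsW]
      exact hF.cmu_le hθ (ha s hsW)
    gcongr
  have hV' : matNorm (designMatrix lam cμ τ t a) Δ ≤ beta d T τ lam S m kμ δ t / kμ / √cμ :=
    hV.trans (div_le_div_of_nonneg_right hQle (Real.sqrt_nonneg _))
  calc |F.mean (inner ℝ x θh) - F.mean (inner ℝ x (θ t))|
      ≤ kμ * |inner ℝ x θh - inner ℝ x (θ t)| := hF.lipschitz _ _
    _ = kμ * |inner ℝ x Δ| := by rw [hΔ, inner_sub_right]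
    _ ≤ kμ * (N * (beta d T τ lam S m kμ δ t / kμ / √cμ)) :=
        mul_le_mul_of_nonneg_left ((abs_inner_le_matNorm_inv hpd x Δ).trans
          (mul_le_mul_of_nonneg_left hV' hN0)) hk.le
    _ = _ := by field_simp

end Estimation


/-! ### Optimism, rounds spoiled by changes, and the sum of bonuses. -/

section Regret

variable {d : ℕ} {F : ExpFamily} {T τ t : ℕ} {lam S m kμ δ : ℝ}

/-- The instantaneous dynamic regret over the action set `B` when the parameter is `η` and `x` is
played. -/
noncomputable def instRegret (F : ExpFamily) (η : Vec d) (B : Set (Vec d)) (x : Vec d) : ℝ :=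
  sSup ((fun z : Vec d => F.mean (inner ℝ z η)) '' B) - F.mean (inner ℝ x η)

lemma regret_eq_sum {Ω : Type*} (F : ExpFamily) (T : ℕ) (θ : ℕ → Vec d)
    (A : ℕ → Ω → Set (Vec d)) (a : ℕ → Ω → Vec d) (ω : Ω) :
    regret F T θ A a ω = ∑ t ∈ Finset.Icc 1 T, instRegret F (θ t) (A t ω) (a t ω) := rfl

lemma ExpFamily.SupportedIn.instRegret_le (h : F.SupportedIn m) {η : Vec d} {B : Set (Vec d)}
    {x : Vec d} (hx : x ∈ B) : instRegret F η B x ≤ m := by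
  have h1 : sSup ((fun z : Vec d => F.mean (inner ℝ z η)) '' B) ≤ m := by
    refine csSup_le ⟨_, x, hx, rfl⟩ ?_
    rintro _ ⟨z, -, rfl⟩
    exact (h.mean_mem _).2
  have h2 := (h.mean_mem (inner ℝ x η)).1
  rw [instRegret]
  linarith

/-- Optimism: if all predictions are within the bonus, an optimistic action has regret at most
twice its bonus. -/
lemma instRegret_le_two_mul_bonus {η θh : Vec d} {B : Set (Vec d)} {x : Vec d} (hx : x ∈ B)
    {bonus : Vec d → ℝ}
    (hpred : ∀ z, |F.mean (inner ℝ z θh) - F.mean (inner ℝ z η)| ≤ bonus z)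
    (hmax : ∀ z ∈ B, F.mean (inner ℝ z θh) + bonus z ≤ F.mean (inner ℝ x θh) + bonus x) :
    instRegret F η B x ≤ 2 * bonus x := by
  have h1 : sSup ((fun z : Vec d => F.mean (inner ℝ z η)) '' B)
      ≤ F.mean (inner ℝ x η) + 2 * bonus x := by
    refine csSup_le ⟨_, x, hx, rfl⟩ ?_
    rintro _ ⟨z, hz, rfl⟩
    have h2 := abs_le.1 (hpred z)
    have h3 := abs_le.1 (hpred x)
    have h4 := hmax z hz
    simp only
    linarith [h2.1, h3.2]
  rw [instRegret]
  linarith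

open Classical in
/-- The rounds at which the parameter is not constant over the sliding window. -/
noncomputable def unstableRounds (T τ : ℕ) (θ : ℕ → Vec d) : Finset ℕ :=
  {t ∈ Finset.Icc 1 T | ∃ s ∈ window τ t, θ s ≠ θ t}

lemma exists_change {E : Type*} {θ : ℕ → E} {s t : ℕ} (hst : s ≤ t) (h : θ s ≠ θ t) :
    ∃ u, s < u ∧ u ≤ t ∧ θ u ≠ θ (u - 1) := by
  induction t, hst using Nat.le_induction with
  | base => exact absurd rfl h
  | succ t hst ih =>
    by_cases h' : θ s = θ t
    · exact ⟨t + 1, by omega, le_rfl, by rw [Nat.add_sub_cancel, ← h']; exact h.symm⟩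
    · obtain ⟨u, h1, h2, h3⟩ := ih h'
      exact ⟨u, h1, by omega, h3⟩

/-- If the parameter differs at `t` and at some `s ≥ t - τ`, a change `u` lies in `(s, t]`, so `t`
is one of the `τ` rounds of `[u, u + τ)`. -/
lemma card_unstableRounds_le (T τ : ℕ) (θ : ℕ → Vec d) :
    (unstableRounds T τ θ).card ≤ numChanges T θ * τ := by
  classical
  have hfin : {t : ℕ | 2 ≤ t ∧ t ≤ T ∧ θ t ≠ θ (t - 1)}.Finite :=
    (Set.finite_Icc 2 T).subset fun t ht => ⟨ht.1, ht.2.1⟩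
  have hsub : unstableRounds T τ θ
      ⊆ hfin.toFinset.biUnion fun u => Finset.Ico u (u + τ) := by
    intro t ht
    simp only [unstableRounds, Finset.mem_filter, Finset.mem_Icc] at ht
    obtain ⟨⟨ht1, htT⟩, s, hs, hne⟩ := ht
    rw [mem_window] at hs
    obtain ⟨u, h1, h2, h3⟩ := exists_change hs.2.2.le hne
    rw [Finset.mem_biUnion]
    refine ⟨u, ?_, by simp; omega⟩
    rw [Set.Finite.mem_toFinset]
    exact ⟨by omega, by omega, h3⟩
  calc (unstableRounds T τ θ).card
      ≤ (hfin.toFinset.biUnion fun u => Finset.Ico u (u + τ)).card := Finset.card_le_card hsub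
    _ ≤ hfin.toFinset.card * τ := Finset.card_biUnion_le_card_mul _ _ _ fun u _ => by simp
    _ = numChanges T θ * τ := by rw [numChanges, Set.ncard_eq_toFinset_card _ hfin]

/-- The elliptical potential of the sliding window. -/
lemma sum_sq_matNorm_le (hd : 1 ≤ d) (hτ : 1 ≤ τ) {c : ℝ} (hlam : 0 < lam) (hc : 0 < c)
    {a : ℕ → Vec d} (ha : ∀ s ∈ Finset.Icc 1 T, ‖a s‖ ≤ 1) :
    ∑ t ∈ Finset.Icc 1 T, matNorm (designMatrix lam c τ t a)⁻¹ (a t) ^ 2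
      ≤ (⌈(T : ℝ) / τ⌉₊ : ℝ) * (2 * max 1 (c / lam) * (d * Real.log (1 + c * τ / (d * lam)))) := by
  have hl : 0 < lam / c := by positivity
  have hd0 : (0 : ℝ) < d := by exact_mod_cast hd
  have hτ0 : (0 : ℝ) < τ := by exact_mod_cast hτ
  have hpd : ∀ t, (designMatrix lam c τ t a).PosDef := fun t => by
    rw [designMatrix_eq]
    exact weightedGram_posDef (fun _ _ => zero_le_one) a hl
  set K := ⌈(T : ℝ) / τ⌉₊ with hK
  have hKT : T ≤ K * τ := by
    have := Nat.le_ceil ((T : ℝ) / τ)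
    rw [div_le_iff₀ hτ0, ← hK] at this
    exact_mod_cast this
  have hmaps : ∀ t ∈ Finset.Icc 1 T, (t - 1) / τ ∈ Finset.range K := fun t ht => by
    rw [Finset.mem_Icc] at ht
    rw [Finset.mem_range, Nat.div_lt_iff_lt_mul (by omega)]
    omega
  -- The horizon is cut into `K` blocks of length `τ`. Within a block, all earlier rounds of the
  -- block lie in the window, so the design matrix dominates that of the block and the potential
  -- argument, which needs growing matrices, applies.
  rw [← Finset.sum_fiberwise_of_maps_to hmaps]
  have hblock : ∀ k ∈ Finset.range K,
      ∑ t ∈ Finset.Icc 1 T with (t - 1) / τ = k, matNorm (designMatrix lam c τ t a)⁻¹ (a t) ^ 2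
      ≤ 2 * max 1 (c / lam) * (d * Real.log (1 + c * τ / (d * lam))) := by
    intro k _
    set p := k * τ + 1 with hp
    set q := min ((k + 1) * τ) T + 1 with hq
    have hmem : ∀ t, t ∈ ({t ∈ Finset.Icc 1 T | (t - 1) / τ = k} : Finset ℕ)
        ↔ t ∈ Finset.Ico p q := fun t => by
      rw [Finset.mem_filter, Finset.mem_Icc, Finset.mem_Ico, Nat.div_eq_iff (by omega), hp, hq]
      have : (k + 1) * τ = k * τ + τ := by ring
      omega
    have hset : ({t ∈ Finset.Icc 1 T | (t - 1) / τ = k} : Finset ℕ) = Finset.Ico p q :=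
      Finset.ext hmem
    rw [hset]
    have hR0 : 0 ≤ 2 * max 1 (c / lam) * (d * Real.log (1 + c * τ / (d * lam))) := by
      have : 0 ≤ Real.log (1 + c * τ / (d * lam)) :=
        Real.log_nonneg (le_add_of_nonneg_right (by positivity))
      positivity
    rcases lt_or_ge q p with hlt | hpq
    · rw [Finset.Ico_eq_empty (by omega)]
      simpa using hR0
    have hqp : q - p ≤ τ := by
      have : (k + 1) * τ = k * τ + τ := by ring
      omega
    have hain : ∀ s ∈ Finset.Ico p q, ‖a s‖ ≤ 1 := fun s hs =>
      ha s (Finset.mem_of_mem_filter s ((hmem s).2 hs))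
    have hsum := sum_inv_form_le hd hl p q τ hpq hqp hain
    have e1 : 1 / (lam / c) = c / lam := by field_simp
    have e2 : (τ : ℝ) / (d * (lam / c)) = c * τ / (d * lam) := by field_simp
    rw [e1, e2] at hsum
    refine le_trans (Finset.sum_le_sum fun t ht => ?_) hsum
    rw [sq_matNorm_inv (hpd t)]
    refine inv_form_anti (hpd t) (weightedGram_posDef (fun _ _ => zero_le_one) a hl) (fun y => ?_) _
    have h1 := dotProduct_weightedGram (window τ t) (fun _ => 1) a (lam / c) (WithLp.toLp 2 y)
    have h2 := dotProduct_weightedGram (Finset.Ico p t) (fun _ => 1) a (lam / c) (WithLp.toLp 2 y)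
    simp only at h1 h2
    rw [designMatrix_eq, h1, h2, gramForm, gramForm]
    refine add_le_add (Finset.sum_le_sum_of_subset_of_nonneg (fun s hs => ?_)
      fun s _ _ => by positivity) le_rfl
    rw [mem_window]
    rw [Finset.mem_Ico] at hs ht
    have : (k + 1) * τ = k * τ + τ := by ring
    omega
  refine (Finset.sum_le_sum hblock).trans (le_of_eq ?_)
  rw [Finset.sum_const, Finset.card_range, nsmul_eq_mul]

lemma sum_matNorm_le (hd : 1 ≤ d) (hτ : 1 ≤ τ) {c : ℝ} (hlam : 0 < lam) (hc : 0 < c)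
    {a : ℕ → Vec d} (ha : ∀ s ∈ Finset.Icc 1 T, ‖a s‖ ≤ 1) :
    ∑ t ∈ Finset.Icc 1 T, matNorm (designMatrix lam c τ t a)⁻¹ (a t)
      ≤ √(d * T) * √(⌈(T : ℝ) / τ⌉₊ : ℝ) * √(2 * max 1 (c / lam))
        * √(Real.log (1 + c * τ / (d * lam))) := by
  have h1 := sum_sq_matNorm_le hd hτ hlam hc ha
  have h2 := sq_sum_le_card_mul_sum_sq (s := Finset.Icc 1 T)
    (f := fun t => matNorm (designMatrix lam c τ t a)⁻¹ (a t))
  rw [Nat.card_Icc, Nat.add_sub_cancel] at h2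
  rw [← Real.sqrt_mul (by positivity), ← Real.sqrt_mul (by positivity),
    ← Real.sqrt_mul (by positivity)]
  refine Real.le_sqrt_of_sq_le (h2.trans ?_)
  calc _ ≤ (T : ℝ) * ((⌈(T : ℝ) / τ⌉₊ : ℝ)
        * (2 * max 1 (c / lam) * (d * Real.log (1 + c * τ / (d * lam))))) := by gcongr
    _ = _ := by ring

/-- The regret bound on the event where all scores are bounded. -/
lemma sum_instRegret_le (hd : 1 ≤ d) (hT : 1 ≤ T) (hτ : 1 ≤ τ) (hlam : 0 < lam) (hm : 0 < m)
    (hδ : 0 < δ) (hδ1 : δ ≤ 1) (hF : F.LinkAssumptions d S kμ) (hsupp : F.SupportedIn m)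
    {θ : ℕ → Vec d} {A : ℕ → Set (Vec d)} {a : ℕ → Vec d} {r : ℕ → ℝ} {θh : ℕ → Vec d} {Γ : ℕ}
    (hθ : ∀ t ∈ Finset.Icc 1 T, ‖θ t‖ ≤ S) (hA : ∀ t ∈ Finset.Icc 1 T, ∀ x ∈ A t, ‖x‖ ≤ 1)
    (ha : ∀ t ∈ Finset.Icc 1 T, a t ∈ A t) (hΓ : numChanges T θ ≤ Γ)
    (hmle : ∀ t ∈ Finset.Icc 1 T, IsMaxOn (penLogLik F lam τ t a r) Set.univ (θh t))
    (hopt : ∀ t ∈ Finset.Icc 1 T, IsMaxOn (ucb F T τ lam S m kμ δ t a (θh t)) (A t) (a t))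
    (hscore : ∀ t ∈ Finset.Icc 1 T, ScoreBound F T τ lam m kμ δ θ a r t) :
    ∑ t ∈ Finset.Icc 1 T, instRegret F (θ t) (A t) (a t)
      ≤ m * Γ * τ + 2 * beta d T τ lam S m kμ δ T / √(F.cmu d S)
          * √(d * T) * √(⌈(T : ℝ) / τ⌉₊ : ℝ) * √(2 * max 1 (F.cmu d S / lam))
          * √(Real.log (1 + F.cmu d S * τ / (d * lam))) := by
  classical
  have hS : 0 ≤ S := (norm_nonneg _).trans (hθ 1 (by simpa using hT))
  have hk := hF.lipschitz_pos hS
  have hcμ := hF.cmu_pos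
  set cμ := F.cmu d S with hcμdef
  have ha1 : ∀ t ∈ Finset.Icc 1 T, ‖a t‖ ≤ 1 := fun t ht => hA t ht _ (ha t ht)
  set N : ℕ → ℝ := fun t => matNorm (designMatrix lam cμ τ t a)⁻¹ (a t) with hN
  have hN0 : ∀ t, 0 ≤ N t := fun t => Real.sqrt_nonneg _
  set bT := beta d T τ lam S m kμ δ T with hbT
  have hbT0 : 0 ≤ bT := beta_nonneg hT hlam hm hk hδ hδ1 hS T
  have hround : ∀ t ∈ Finset.Icc 1 T, instRegret F (θ t) (A t) (a t)
      ≤ (if t ∈ unstableRounds T τ θ then m else 0) + 2 * bT / √cμ * N t := by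
    intro t ht
    by_cases hun : t ∈ unstableRounds T τ θ
    · rw [if_pos hun]
      have h1 := hsupp.instRegret_le (η := θ t) (ha t ht)
      have h2 := hN0 t
      have : 0 ≤ 2 * bT / √cμ * N t := by positivity
      linarith
    · rw [if_neg hun, zero_add]
      have hconst : ∀ s ∈ window τ t, θ s = θ t := by
        simp only [unstableRounds, Finset.mem_filter, not_and, not_exists] at hun
        intro s hs
        by_contra h
        exact hun ht s hs h
      have hpred := abs_mean_sub_le hT hlam hm hδ hδ1 hS hF
        (fun s hs => ha1 s (mem_Icc_of_mem_window ht hs)) (hθ t ht) hconst (hmle t ht)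
        (hscore t ht)
      have h1 := instRegret_le_two_mul_bonus (ha t ht) hpred fun z hz => by
        simpa [ucb] using hopt t ht hz
      refine h1.trans ?_
      have hbt : beta d T τ lam S m kμ δ t ≤ bT :=
        beta_mono hT hlam hm hk hδ hδ1 hS (Finset.mem_Icc.1 ht).2
      calc _ = 2 * beta d T τ lam S m kμ δ t / √cμ * N t := by rw [hN]; ring
        _ ≤ _ := by have := hN0 t; gcongr
  refine (Finset.sum_le_sum hround).trans ?_
  rw [Finset.sum_add_distrib, ← Finset.mul_sum]
  refine add_le_add ?_ ?_
  · rw [← Finset.sum_filter, Finset.sum_const, nsmul_eq_mul]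
    have h1 : (Finset.filter (fun t => t ∈ unstableRounds T τ θ) (Finset.Icc 1 T)).card
        ≤ Γ * τ := by
      refine (Finset.card_le_card fun t ht => (Finset.mem_filter.1 ht).2).trans
        ((card_unstableRounds_le T τ θ).trans ?_)
      gcongr
    have h2 : ((Finset.filter (fun t => t ∈ unstableRounds T τ θ) (Finset.Icc 1 T)).card : ℝ)
        ≤ Γ * τ := by exact_mod_cast h1
    nlinarith
  · have h1 := sum_matNorm_le hd hτ hlam hcμ ha1
    calc _ ≤ 2 * bT / √cμ * (√(d * T) * √(⌈(T : ℝ) / τ⌉₊ : ℝ) * √(2 * max 1 (cμ / lam))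
        * √(Real.log (1 + cμ * τ / (d * lam)))) := by gcongr
      _ = _ := by ring

variable {Ω : Type*} [MeasurableSpace Ω] {P : Measure Ω} [IsProbabilityMeasure P]
  {ℱ : Filtration ℕ ‹MeasurableSpace Ω›} {θ : ℕ → Vec d}
  {A : ℕ → Ω → Set (Vec d)} {a : ℕ → Ω → Vec d} {r : ℕ → Ω → ℝ} {θhat : ℕ → Ω → Vec d}

/-- The high-probability bound on the dynamic regret. -/
theorem measure_regret_le_ge {Γ : ℕ} (hd : 1 ≤ d) (hT : 1 ≤ T) (hτ : 1 ≤ τ) (hlam : 0 < lam)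
    (hm : 0 < m) (hδ : 0 < δ) (hδ1 : δ ≤ 1) (hF : F.LinkAssumptions d S kμ)
    (hB : IsBandit F P ℱ T S m θ A a r) (hΓ : numChanges T θ ≤ Γ)
    (hAlg : IsSWGLUCB F P T τ lam S m kμ δ A a r θhat) :
    ENNReal.ofReal (1 - δ) ≤ P {ω | regret F T θ A a ω ≤
      m * Γ * τ + 2 * beta d T τ lam S m kμ δ T / √(F.cmu d S)
          * √(d * T) * √(⌈(T : ℝ) / τ⌉₊ : ℝ) * √(2 * max 1 (F.cmu d S / lam))
          * √(Real.log (1 + F.cmu d S * τ / (d * lam)))} := by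
  have hS : 0 ≤ S := (norm_nonneg _).trans (hB.norm_param_le 1 (by simpa using hT))
  refine (hB.measure_forall_scoreBound_ge (τ := τ) hd hT hlam hm hδ hS hF).trans
    (measure_mono_ae ?_)
  filter_upwards [hB.norm_action_le, hB.action_mem, hAlg.isMLE, hAlg.optimistic]
    with ω h1 h2 h3 h4 h5
  exact sum_instRegret_le hd hT hτ hlam hm hδ hδ1 hF (hB.supportedIn hT) hB.norm_param_le h1 h2 hΓ
    h3 h4 h5

/-- The dynamic regret is almost surely at most `m T`. -/
theorem regret_le_mul_horizon (hT : 1 ≤ T) (hB : IsBandit F P ℱ T S m θ A a r) :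
    ∀ᵐ ω ∂P, regret F T θ A a ω ≤ m * T := by
  filter_upwards [hB.action_mem] with ω h
  rw [regret_eq_sum]
  refine (Finset.sum_le_card_nsmul _ _ m fun t ht =>
    (hB.supportedIn hT).instRegret_le (h t ht)).trans (le_of_eq ?_)
  rw [Nat.card_Icc, Nat.add_sub_cancel, nsmul_eq_mul, mul_comm]

/-- The variance of rewards in `[0, m]` bounds `c_μ`. -/
lemma cmu_le_sq (hT : 1 ≤ T) (hF : F.LinkAssumptions d S kμ)
    (hB : IsBandit F P ℱ T S m θ A a r) : F.cmu d S ≤ (m / 2) ^ 2 := by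
  have hS : 0 ≤ S := (norm_nonneg _).trans (hB.norm_param_le 1 (by simpa using hT))
  exact (hF.cmu_le (θ := 0) (a := 0) (by simpa) (by simp)).trans
    ((hB.supportedIn hT).deriv_mean_le _)

end Regret


/-! ### The tuned regularization and the ideal window. -/

section Tuning

/-- Allows every additive constant, and every lower power of `log (T / δ)`, to be absorbed into a
higher power. -/
lemma half_le_log {T : ℕ} (hT : 2 ≤ T) : 1 / 2 ≤ Real.log T := by
  have h1 : Real.log 2 ≤ Real.log T := Real.log_le_log (by norm_num) (by exact_mod_cast hT)
  linarith [Real.log_two_gt_d9]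

lemma log_le_log_div {T : ℕ} (hT : 2 ≤ T) {δ : ℝ} (hδ : 0 < δ) (hδ1 : δ ≤ 1) :
    Real.log T ≤ Real.log (T / δ) := by
  have hT0 : (0 : ℝ) < T := by exact_mod_cast (by omega : 0 < T)
  exact Real.log_le_log hT0 (by rw [le_div_iff₀ hδ]; nlinarith)

lemma log_one_add_mul_div_le {d T n : ℕ} (hd : 1 ≤ d) (hT : 2 ≤ T) (hn : n ≤ T) {k : ℝ}
    (hk : 0 ≤ k) :
    Real.log (1 + k * n / (d * (d * Real.log T))) ≤ 2 * k + Real.log T := by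
  have hT1 : (2 : ℝ) ≤ T := by exact_mod_cast hT
  have hd1 : (1 : ℝ) ≤ d := by exact_mod_cast hd
  have hℓ := half_le_log hT
  have hn' : (n : ℝ) ≤ T := by exact_mod_cast hn
  have h1 : 1 / 2 ≤ (d : ℝ) * (d * Real.log T) := by
    have : Real.log T ≤ d * Real.log T := le_mul_of_one_le_left (by linarith) hd1
    have : d * Real.log T ≤ d * (d * Real.log T) := le_mul_of_one_le_left (by positivity) hd1
    linarith
  have h2 : k * n / (d * (d * Real.log T)) ≤ 2 * k * T := by
    rw [div_le_iff₀ (by linarith)]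
    have : k * n ≤ k * T := by gcongr
    have : 2 * k * T * (1 / 2) ≤ 2 * k * T * (d * (d * Real.log T)) := by gcongr
    linarith
  have h3 : 1 + k * n / (d * (d * Real.log T)) ≤ (1 + 2 * k) * T := by linarith
  have hpos : 0 < 1 + k * n / (d * (d * Real.log T)) := by positivity
  refine (Real.log_le_log hpos h3).trans ?_
  rw [Real.log_mul (by positivity) (by positivity)]
  have := Real.log_le_sub_one_of_pos (show 0 < 1 + 2 * k by linarith)
  linarith

/-- Constant in the bound of `ρ / √λ` by `log (T / δ)`. -/
noncomputable def rhoConst (m kμ : ℝ) : ℝ := 1 / m + 14 * m + 8 * m * kμ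

/-- Constant in the bound of `β` for the tuned regularization. -/
noncomputable def betaConst (S m kμ : ℝ) : ℝ :=
  kμ * (4 * (1 + S) + 2 * √(1 + S) * rhoConst m kμ + rhoConst m kμ ^ 2) ^ (3 / 2 : ℝ)

variable {d T τ : ℕ} {S m kμ δ : ℝ}

lemma rho_div_sqrt_le (hd : 1 ≤ d) (hT : 2 ≤ T) (hm : 0 < m) (hk : 0 < kμ) (hδ : 0 < δ)
    (hδ1 : δ ≤ 1) :
    rho d T τ (d * Real.log T) m kμ δ T / √(d * Real.log T)
      ≤ rhoConst m kμ * Real.log (T / δ) := by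
  have hd1 : (1 : ℝ) ≤ d := by exact_mod_cast hd
  have hℓ := half_le_log hT
  have hL := log_le_log_div hT hδ hδ1
  have h1 := log_one_add_mul_div_le hd hT (min_le_left T τ) hk.le
  set ℓ := Real.log T with hℓdef
  set L := Real.log (T / δ) with hLdef
  set J := Real.log (1 + kμ * (min T τ : ℕ) / (d * (d * ℓ))) with hJ
  have hlam : 0 < d * ℓ := by positivity
  have hlam' : 1 / 2 ≤ d * ℓ := by nlinarith
  have hs : 0 < √(d * ℓ) := Real.sqrt_pos.2 hlam
  have hs2 : √(d * ℓ) * √(d * ℓ) = d * ℓ := Real.mul_self_sqrt hlam.le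
  have e : rho d T τ (d * ℓ) m kμ δ T / √(d * ℓ)
      = 1 / (2 * m) + 2 * m * L / (d * ℓ) + m * (J / ℓ) + 2 * m * Real.log 2 / ℓ := by
    have hrho : rho d T τ (d * ℓ) m kμ δ T = √(d * ℓ) / (2 * m) + 2 * m / √(d * ℓ) * L
        + d * m / √(d * ℓ) * J + 2 * m / √(d * ℓ) * d * Real.log 2 := rfl
    have e1 : √(d * ℓ) / (2 * m) / √(d * ℓ) = 1 / (2 * m) := by field_simp
    have e2 : ∀ x y : ℝ, x / √(d * ℓ) * y / √(d * ℓ) = x * y / (d * ℓ) := fun x y => by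
      rw [div_mul_eq_mul_div, div_div, hs2]
    have e3 : 2 * m / √(d * ℓ) * d * Real.log 2 = 2 * m / √(d * ℓ) * (d * Real.log 2) := by ring
    rw [hrho, e3, add_div, add_div, add_div, e1, e2, e2, e2]
    congr 1
    · congr 1
      field_simp
    · field_simp
  rw [e]
  have t1 : 2 * m * L / (d * ℓ) ≤ 4 * m * L := by
    rw [div_le_iff₀ hlam]
    have : 4 * m * L * (1 / 2) ≤ 4 * m * L * (d * ℓ) := by
      have : 0 ≤ L := by linarith
      gcongr
    linarith
  have t2 : J / ℓ ≤ 4 * kμ + 1 := by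
    rw [div_le_iff₀ (by linarith)]
    nlinarith
  have t3 : 2 * m * Real.log 2 / ℓ ≤ 4 * m := by
    rw [div_le_iff₀ (by linarith)]
    have := Real.log_two_lt_d9
    nlinarith
  have t4 : m * (J / ℓ) ≤ m * (4 * kμ + 1) := by gcongr
  have t5 : 1 / (2 * m) = 1 / m * (1 / 2) := by field_simp
  have h2L : 1 ≤ 2 * L := by linarith
  have hm' : 0 < 1 / m := by positivity
  have hmk : 0 < m * kμ := by positivity
  -- Terms free of `L` are multiplied by `2 * L ≥ 1`; the coefficient of `m` becomes `4 + 2 + 8 =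
  -- 14`.
  rw [t5, rhoConst]
  nlinarith

lemma rhoConst_nonneg (hm : 0 < m) (hk : 0 < kμ) : 0 ≤ rhoConst m kμ := by
  unfold rhoConst
  positivity

lemma betaConst_nonneg (hm : 0 < m) (hk : 0 < kμ) (hS : 0 ≤ S) : 0 ≤ betaConst S m kμ := by
  have := rhoConst_nonneg hm hk
  unfold betaConst
  positivity

lemma beta_le (hd : 1 ≤ d) (hT : 2 ≤ T) (hm : 0 < m) (hk : 0 < kμ) (hS : 0 ≤ S) (hδ : 0 < δ)
    (hδ1 : δ ≤ 1) :
    beta d T τ (d * Real.log T) S m kμ δ T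
      ≤ betaConst S m kμ * √d * √(Real.log (T / δ)) * Real.log (T / δ) ^ 3 := by
  have hd1 : (1 : ℝ) ≤ d := by exact_mod_cast hd
  have hℓ := half_le_log hT
  have hL := log_le_log_div hT hδ hδ1
  have hκ := rho_div_sqrt_le (τ := τ) hd hT hm hk hδ hδ1
  have hK := rhoConst_nonneg hm hk
  set ℓ := Real.log T with hℓdef
  set L := Real.log (T / δ) with hLdef
  set K := rhoConst m kμ with hKdef
  have hL0 : 1 / 2 ≤ L := by linarith
  have hlam : 0 < d * ℓ := by positivity
  have hρ0 := rho_nonneg (d := d) (τ := τ) (by omega : 1 ≤ T) hlam hm hk hδ hδ1 T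
  set ρ := rho d T τ (d * ℓ) m kμ δ T with hρ
  have hs : 0 < √(d * ℓ) := Real.sqrt_pos.2 hlam
  have hκ0 : 0 ≤ ρ / √(d * ℓ) := by positivity
  have e1 : √((1 + S) / (d * ℓ)) * ρ = √(1 + S) * (ρ / √(d * ℓ)) := by
    rw [Real.sqrt_div (by linarith)]
    ring
  have hB : 1 + S + √((1 + S) / (d * ℓ)) * ρ + (ρ / √(d * ℓ)) ^ 2
      ≤ (4 * (1 + S) + 2 * √(1 + S) * K + K ^ 2) * L ^ 2 := by
    rw [e1]
    have h1 : √(1 + S) * (ρ / √(d * ℓ)) ≤ √(1 + S) * (K * L) := by gcongr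
    have h2 : (ρ / √(d * ℓ)) ^ 2 ≤ (K * L) ^ 2 := by gcongr
    have h3 : 1 ≤ 4 * L ^ 2 := by nlinarith
    have h4 : L ≤ 2 * L ^ 2 := by nlinarith
    have h5 : √(1 + S) * K * L ≤ √(1 + S) * K * (2 * L ^ 2) := by gcongr
    have h6 : (1 + S) * 1 ≤ (1 + S) * (4 * L ^ 2) := by gcongr
    linarith
  have hpow : (L ^ 2) ^ (3 / 2 : ℝ) = L ^ 3 := by
    rw [← Real.rpow_natCast, ← Real.rpow_natCast, ← Real.rpow_mul (by linarith)]
    norm_num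
  have hbeta : beta d T τ (d * ℓ) S m kμ δ T = kμ * √(d * ℓ)
      * (1 + S + √((1 + S) / (d * ℓ)) * ρ + (ρ / √(d * ℓ)) ^ 2) ^ (3 / 2 : ℝ) := rfl
  rw [hbeta]
  calc _ ≤ kμ * √(d * L)
        * ((4 * (1 + S) + 2 * √(1 + S) * K + K ^ 2) * L ^ 2) ^ (3 / 2 : ℝ) := by gcongr
    _ = _ := by
        rw [Real.mul_rpow (by positivity) (by positivity), hpow, Real.sqrt_mul (by positivity),
          betaConst]
        ring

/-- Constant in the leading term of the regret for the tuned regularization. -/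
noncomputable def leadConst (S m kμ : ℝ) : ℝ :=
  2 * betaConst S m kμ * √2 * √(2 * (1 + 2 * kμ)) * √(4 * kμ + 1)

lemma leadConst_nonneg (hm : 0 < m) (hk : 0 < kμ) (hS : 0 ≤ S) : 0 ≤ leadConst S m kμ := by
  have := betaConst_nonneg hm hk hS
  unfold leadConst
  positivity

lemma ceil_div_le_two_mul (hτ : 1 ≤ τ) (hτT : τ ≤ T) : (⌈(T : ℝ) / τ⌉₊ : ℝ) ≤ 2 * (T / τ) := by
  have hτ0 : (0 : ℝ) < τ := by exact_mod_cast hτ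
  have h1 : (1 : ℝ) ≤ T / τ := by
    rw [le_div_iff₀ hτ0, one_mul]
    exact_mod_cast hτT
  have := (Nat.ceil_lt_add_one (show (0 : ℝ) ≤ T / τ by linarith)).le
  linarith

/-- The fourth power of the logarithm splits as `7 / 2` from `beta` and `1 / 2` from the elliptical
potential; `√d` from `beta` meets `√d` from the potential. -/
lemma leading_term_le {c : ℝ} (hd : 1 ≤ d) (hT : 2 ≤ T) (hm : 0 < m) (hk : 0 < kμ) (hS : 0 ≤ S)
    (hδ : 0 < δ) (hδ1 : δ ≤ 1) (hτ : 1 ≤ τ) (hτT : τ ≤ T) (hc : 0 < c) (hck : c ≤ kμ) :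
    2 * beta d T τ (d * Real.log T) S m kμ δ T / √c
          * √(d * T) * √(⌈(T : ℝ) / τ⌉₊ : ℝ) * √(2 * max 1 (c / (d * Real.log T)))
          * √(Real.log (1 + c * τ / (d * (d * Real.log T))))
      ≤ leadConst S m kμ * Real.log (T / δ) ^ 4 * (d * T / (√c * √τ)) := by
  have hd1 : (1 : ℝ) ≤ d := by exact_mod_cast hd
  have hτ0 : (0 : ℝ) < τ := by exact_mod_cast hτ
  have hℓ := half_le_log hT
  have hL := log_le_log_div hT hδ hδ1
  have hβ := beta_le (τ := τ) hd hT hm hk hS hδ hδ1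
  have hlog := log_one_add_mul_div_le hd hT hτT hc.le
  have hceil := ceil_div_le_two_mul hτ hτT
  have hK := betaConst_nonneg hm hk hS
  set ℓ := Real.log T with hℓdef
  set L := Real.log (T / δ) with hLdef
  set K := betaConst S m kμ with hKdef
  have hL0 : 1 / 2 ≤ L := by linarith
  have hlam : 1 / 2 ≤ d * ℓ := by nlinarith
  have h1 : max 1 (c / (d * ℓ)) ≤ 1 + 2 * kμ := by
    refine max_le (by linarith) ?_
    rw [div_le_iff₀ (by linarith)]
    nlinarith
  have h2 : Real.log (1 + c * τ / (d * (d * ℓ))) ≤ (4 * kμ + 1) * L := by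
    refine hlog.trans ?_
    nlinarith
  calc _ ≤ 2 * (K * √d * √L * L ^ 3) / √c * √(d * T) * √(2 * (T / τ))
        * √(2 * (1 + 2 * kμ)) * √((4 * kμ + 1) * L) := by gcongr
    _ = (2 * K * √2 * √(2 * (1 + 2 * kμ)) * √(4 * kμ + 1)) * (L ^ 3 * (√L * √L))
        * ((√d * √d) * (√T * √T) / (√c * √τ)) := by
        rw [Real.sqrt_mul (by positivity), Real.sqrt_mul (by norm_num : (0 : ℝ) ≤ 2) (T / τ : ℝ),
          Real.sqrt_div (by positivity), Real.sqrt_mul (by positivity) L]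
        field_simp
    _ = _ := by
        rw [Real.mul_self_sqrt (by linarith), Real.mul_self_sqrt (by linarith),
          Real.mul_self_sqrt (by positivity), leadConst, ← hKdef]
        ring

/-- Constant in the tuned regret bounds. -/
noncomputable def tunedConst (S m kμ : ℝ) : ℝ :=
  16 * (m * (2 + kμ ^ (1 / 3 : ℝ))) + √2 * leadConst S m kμ

/-- The ideal window length when the number of changes is taken to be `g`. -/
noncomputable def idealWindow (d T : ℕ) (c g : ℝ) : ℝ :=
  ((d * T : ℝ) / (c ^ (1 / 2 : ℝ) * g)) ^ (2 / 3 : ℝ)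

lemma idealWindow_eq {c g : ℝ} (hc : 0 < c) (hg : 0 < g) :
    idealWindow d T c g = c ^ (-(1 / 3) : ℝ) * (d : ℝ) ^ (2 / 3 : ℝ) * (T : ℝ) ^ (2 / 3 : ℝ)
      / g ^ (2 / 3 : ℝ) := by
  rw [idealWindow, Real.div_rpow (by positivity) (by positivity),
    Real.mul_rpow (by positivity) (by positivity), Real.mul_rpow (by positivity) (by positivity),
    ← Real.rpow_mul hc.le, Real.rpow_neg hc.le]
  norm_num
  field_simp

/-- A lower bound on the ideal window, from `d ≥ 1` and `c ≤ kμ`. It absorbs the rounding of `τ`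
when `g ≤ T` and handles the horizon when `T < g`. -/
lemma div_rpow_le_mul_idealWindow {c g : ℝ} (hd : 1 ≤ d) (hc : 0 < c) (hck : c ≤ kμ)
    (hg : 0 < g) :
    ((T : ℝ) / g) ^ (2 / 3 : ℝ) ≤ kμ ^ (1 / 3 : ℝ) * idealWindow d T c g := by
  have hk : 0 < kμ := hc.trans_le hck
  have hd1 : (1 : ℝ) ≤ d := by exact_mod_cast hd
  rw [idealWindow_eq hc hg, Real.div_rpow (by positivity) hg.le]
  have h1 : 1 ≤ (d : ℝ) ^ (2 / 3 : ℝ) := Real.one_le_rpow hd1 (by norm_num)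
  have h2 : 1 ≤ kμ ^ (1 / 3 : ℝ) * c ^ (-(1 / 3) : ℝ) := by
    rw [Real.rpow_neg hc.le, ← div_eq_mul_inv, le_div_iff₀ (by positivity), one_mul]
    gcongr
  calc (T : ℝ) ^ (2 / 3 : ℝ) / g ^ (2 / 3 : ℝ)
      ≤ (kμ ^ (1 / 3 : ℝ) * c ^ (-(1 / 3) : ℝ)) * (d : ℝ) ^ (2 / 3 : ℝ)
        * ((T : ℝ) ^ (2 / 3 : ℝ) / g ^ (2 / 3 : ℝ)) :=
        le_mul_of_one_le_left (by positivity) (one_le_mul_of_one_le_of_one_le h2 h1)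
    _ = _ := by ring

/-- The ideal window `X` is defined by `d T / √c = g X ^ (3 / 2)`, and `√X ≤ √2 √τ`. -/
lemma mul_div_le_idealWindow {c g : ℝ} (hc : 0 < c) (hg : 0 < g) (hτ : 0 < τ)
    (hτX : idealWindow d T c g ≤ 2 * τ) :
    d * T / (√c * √τ) ≤ √2 * (g * idealWindow d T c g) := by
  have hτ0 : (0 : ℝ) < √τ := Real.sqrt_pos.2 (by exact_mod_cast hτ)
  have hcs : 0 < √c := Real.sqrt_pos.2 hc
  set X := idealWindow d T c g with hX
  have hX0 : 0 ≤ X := Real.rpow_nonneg (by positivity) _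
  have h1 : (d * T : ℝ) / (√c * g) = X * √X := by
    have hXW : X = ((d * T : ℝ) / (√c * g)) ^ (2 / 3 : ℝ) := by
      rw [hX, idealWindow, ← Real.sqrt_eq_rpow]
    rw [Real.sqrt_eq_rpow X, hXW, ← Real.rpow_mul (by positivity),
      ← Real.rpow_add' (by positivity) (by norm_num)]
    norm_num
  have h2 : √X ≤ √2 * √τ := by
    rw [← Real.sqrt_mul (by norm_num)]
    exact Real.sqrt_le_sqrt hτX
  have h3 : (d * T : ℝ) = √c * g * (X * √X) := by
    rw [← h1]
    field_simp
  rw [h3, div_le_iff₀ (by positivity)]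
  calc √c * g * (X * √X) ≤ √c * g * (X * (√2 * √τ)) := by gcongr
    _ = _ := by ring

/-- In the degenerate cases the trivial regret bound `m T` is already good enough: if `T < g` then
`T / g ≤ (T / g) ^ (2 / 3)`, and if `T < τ` then `T` is at most the ideal window. -/
lemma horizon_le_mul_idealWindow {c g G : ℝ} (hd : 1 ≤ d) (hT : 2 ≤ T) (hc : 0 < c)
    (hck : c ≤ kμ) (hg : 1 ≤ g) (hgG : g ≤ G) (hτ : |(τ : ℝ) - idealWindow d T c g| ≤ 1)
    (h : T < g ∨ T < τ) :
    (T : ℝ) ≤ (2 + kμ ^ (1 / 3 : ℝ)) * (G * idealWindow d T c g) := by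
  have hk : 0 < kμ := hc.trans_le hck
  have hT0 : (2 : ℝ) ≤ T := by exact_mod_cast hT
  have hX := div_rpow_le_mul_idealWindow (T := T) hd hc hck (by linarith : 0 < g)
  have hX0 : 0 ≤ idealWindow d T c g := Real.rpow_nonneg (by positivity) _
  set X := idealWindow d T c g with hXdef
  have hgX : g * X ≤ G * X := by gcongr
  have hk3 : 0 ≤ kμ ^ (1 / 3 : ℝ) := by positivity
  rcases h with h | h
  · have h1 : (T : ℝ) / g ≤ (T / g) ^ (2 / 3 : ℝ) := by
      have := Real.rpow_le_rpow_of_exponent_ge (x := (T : ℝ) / g) (by positivity)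
        (by rw [div_le_one (by linarith)]; exact h.le) (show (2 / 3 : ℝ) ≤ 1 by norm_num)
      rwa [Real.rpow_one] at this
    have h2 := h1.trans hX
    rw [div_le_iff₀ (by linarith)] at h2
    have h3 : kμ ^ (1 / 3 : ℝ) * (g * X) ≤ kμ ^ (1 / 3 : ℝ) * (G * X) := by gcongr
    have h4 : 0 ≤ g * X := by positivity
    nlinarith
  · have h1 : (T : ℝ) + 1 ≤ τ := by exact_mod_cast h
    have h2 := (abs_le.1 hτ).2
    have h3 : X ≤ g * X := le_mul_of_one_le_left hX0 hg
    have h4 : 0 ≤ kμ ^ (1 / 3 : ℝ) * (G * X) :=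
      mul_nonneg hk3 (mul_nonneg (by linarith) hX0)
    nlinarith

end Tuning

/-! ### Regret rates for the tuned window. -/

section Rates

variable {d T τ Γ : ℕ} {S m kμ δ : ℝ} {F : ExpFamily} {Ω : Type*} [MeasurableSpace Ω]
  {P : Measure Ω} [IsProbabilityMeasure P] {ℱ : Filtration ℕ ‹MeasurableSpace Ω›}
  {θ : ℕ → Vec d} {A : ℕ → Ω → Set (Vec d)} {a : ℕ → Ω → Vec d} {r : ℕ → Ω → ℝ}
  {θhat : ℕ → Ω → Vec d}

/-- The regret of the algorithm tuned for `g ≤ Γ` changes. -/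
theorem measure_regret_le_idealWindow_ge {g : ℝ} (hd : 1 ≤ d) (hT : 2 ≤ T) (hτ : 1 ≤ τ)
    (hg : 1 ≤ g) (hgΓ : g ≤ Γ) (hm : 0 < m) (hδ : 0 < δ) (hδ1 : δ ≤ 1)
    (hF : F.LinkAssumptions d S kμ)
    (hB : IsBandit F P ℱ T S m θ A a r) (hΓ : numChanges T θ ≤ Γ)
    (hAlg : IsSWGLUCB F P T τ (d * Real.log T) S m kμ δ A a r θhat)
    (hwin : |(τ : ℝ) - idealWindow d T (F.cmu d S) g| ≤ 1) :
    ENNReal.ofReal (1 - δ) ≤ P {ω | regret F T θ A a ω ≤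
      tunedConst S m kμ * Real.log (T / δ) ^ 4 * (Γ * idealWindow d T (F.cmu d S) g)} := by
  have hT1 : 1 ≤ T := by omega
  have hS : 0 ≤ S := (norm_nonneg _).trans (hB.norm_param_le 1 (by simpa using hT1))
  have hk := hF.lipschitz_pos hS
  have hcμ := hF.cmu_pos
  have hck := hF.cmu_le_lipschitz hS
  have hℓ := half_le_log hT
  have hL := log_le_log_div hT hδ hδ1
  have hd1 : (1 : ℝ) ≤ d := by exact_mod_cast hd
  have hτ1 : (1 : ℝ) ≤ τ := by exact_mod_cast hτ
  have hlead := leadConst_nonneg hm hk hS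
  have hX0 : 0 ≤ idealWindow d T (F.cmu d S) g := Real.rpow_nonneg (by positivity) _
  have hpow : 1 ≤ 16 * Real.log (T / δ) ^ 4 := by
    have : (1 / 2 : ℝ) ^ 4 ≤ Real.log (T / δ) ^ 4 :=
      pow_le_pow_left₀ (by norm_num) (hℓ.trans hL) 4
    linarith
  have hlow := div_rpow_le_mul_idealWindow (T := T) hd hcμ hck (by linarith : 0 < g)
  have hhor := fun h => horizon_le_mul_idealWindow (τ := τ) hd hT hcμ hck hg hgΓ hwin h
  set X := idealWindow d T (F.cmu d S) g with hX
  set L := Real.log (T / δ) with hLdef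
  have hΓX : 0 ≤ Γ * X := by positivity
  have hk3 : 0 < kμ ^ (1 / 3 : ℝ) := by positivity
  have hfirst : ∀ y, y ≤ m * ((2 + kμ ^ (1 / 3 : ℝ)) * (Γ * X)) →
      y ≤ 16 * (m * (2 + kμ ^ (1 / 3 : ℝ))) * L ^ 4 * (Γ * X) := fun y hy => by
    calc y ≤ m * ((2 + kμ ^ (1 / 3 : ℝ)) * (Γ * X)) := hy
      _ ≤ m * ((2 + kμ ^ (1 / 3 : ℝ)) * (Γ * X)) * (16 * L ^ 4) :=
          le_mul_of_one_le_right (by positivity) hpow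
      _ = _ := by ring
  have hsplit : tunedConst S m kμ * L ^ 4 * (Γ * X)
      = 16 * (m * (2 + kμ ^ (1 / 3 : ℝ))) * L ^ 4 * (Γ * X)
        + leadConst S m kμ * L ^ 4 * (√2 * (Γ * X)) := by
    rw [tunedConst]
    ring
  have hL4 : 0 ≤ leadConst S m kμ * L ^ 4 := by positivity
  by_cases htriv : (T : ℝ) < g ∨ T < τ
  · have h1 := hhor htriv
    refine le_trans (b := P Set.univ) ?_ (measure_mono_ae ?_)
    · rw [measure_univ, ENNReal.ofReal_le_one]
      linarith
    filter_upwards [regret_le_mul_horizon hT1 hB] with ω hω _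
    refine le_of_le_of_eq ?_ hsplit.symm
    have h2 := hfirst _ (hω.trans (mul_le_mul_of_nonneg_left h1 hm.le))
    have h3 : 0 ≤ leadConst S m kμ * L ^ 4 * (√2 * (Γ * X)) := by positivity
    linarith
  · push Not at htriv
    refine (measure_regret_le_ge hd hT1 hτ (by positivity) hm hδ hδ1 hF hB hΓ hAlg).trans
      (measure_mono fun ω hω => ?_)
    rw [Set.mem_ofPred_eq] at hω ⊢
    refine hω.trans ?_
    rw [hsplit]
    have hw := abs_le.1 hwin
    -- As `g ≤ T`, the ideal window is bounded below, so `τ ≤ X + 1` is at most a constant times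
    -- `X`.
    have hX1 : 1 ≤ kμ ^ (1 / 3 : ℝ) * X := by
      refine le_trans ?_ hlow
      exact Real.one_le_rpow (by rw [le_div_iff₀ (by linarith)]; linarith [htriv.1]) (by norm_num)
    refine add_le_add (hfirst _ ?_) ?_
    · have h1 : (τ : ℝ) ≤ (2 + kμ ^ (1 / 3 : ℝ)) * X := by nlinarith
      calc m * Γ * τ ≤ m * Γ * ((2 + kμ ^ (1 / 3 : ℝ)) * X) := by gcongr
        _ = _ := by ring
    -- Here `X ≤ 2 * τ` because `X ≤ τ + 1` and `τ ≥ 1`.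
    · refine (leading_term_le hd hT hm hk hS hδ hδ1 hτ htriv.2 hcμ hck).trans
        (mul_le_mul_of_nonneg_left ?_ hL4)
      refine (mul_div_le_idealWindow hcμ (by linarith : 0 < g) (by omega : 0 < τ)
        (by linarith)).trans ?_
      gcongr

/-- The high-probability regret bound for rewards in `[0, m]` with `m ≤ 1`. -/
theorem measure_regret_le_ge_of_le_one {lam : ℝ} (hd : 1 ≤ d) (hT : 1 ≤ T) (hτ : 1 ≤ τ)
    (hlam : 0 < lam) (hm : 0 < m) (hm1 : m ≤ 1) (hδ : 0 < δ) (hδ1 : δ ≤ 1)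
    (hF : F.LinkAssumptions d S kμ)
    (hB : IsBandit F P ℱ T S m θ A a r) (hΓ : numChanges T θ ≤ Γ)
    (hAlg : IsSWGLUCB F P T τ lam S m kμ δ A a r θhat) :
    ENNReal.ofReal (1 - δ) ≤ P {ω | regret F T θ A a ω ≤
      Γ * τ + 2 * beta d T τ lam S m kμ δ T / √(F.cmu d S)
          * √(d * T) * √(⌈(T : ℝ) / τ⌉₊ : ℝ) * √(2 * max 1 (1 / lam))
          * √(Real.log (1 + τ / (d * lam)))} := by
  have hS : 0 ≤ S := (norm_nonneg _).trans (hB.norm_param_le 1 (by simpa using hT))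
  have hk := hF.lipschitz_pos hS
  have hcμ := hF.cmu_pos
  -- `c_μ` is at most a reward variance, hence at most `(m / 2) ^ 2`.
  have hc1 : F.cmu d S ≤ 1 := by
    have := cmu_le_sq hT hF hB
    nlinarith
  have hd0 : (0 : ℝ) < d := by exact_mod_cast hd
  have hβ := beta_nonneg (d := d) (τ := τ) hT hlam hm hk hδ hδ1 hS T
  refine (measure_regret_le_ge hd hT hτ hlam hm hδ hδ1 hF hB hΓ hAlg).trans
    (measure_mono fun ω hω => ?_)
  rw [Set.mem_ofPred_eq] at hω ⊢
  refine hω.trans (add_le_add ?_ ?_)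
  · rw [mul_assoc]
    exact mul_le_of_le_one_left (by positivity) hm1
  · have h1 : F.cmu d S * τ / (d * lam) ≤ τ / (d * lam) := by
      gcongr
      exact mul_le_of_le_one_left (by positivity) hc1
    gcongr

end Rates

end GLB

theorem mainTheorem5 :
    -- the high-probability regret bound
    (∀ (d T τ Γ : ℕ) (lam S m kμ δ : ℝ) (F : GLB.ExpFamily)
        (Ω : Type*) (_ : MeasurableSpace Ω) (P : MeasureTheory.Measure Ω)
        (_ : MeasureTheory.IsProbabilityMeasure P)
        (ℱ : MeasureTheory.Filtration ℕ ‹MeasurableSpace Ω›)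
        (θ : ℕ → GLB.Vec d) (A : ℕ → Ω → Set (GLB.Vec d)) (a : ℕ → Ω → GLB.Vec d)
        (r : ℕ → Ω → ℝ) (θhat : ℕ → Ω → GLB.Vec d),
      1 ≤ d → 1 ≤ T → 1 ≤ τ → 0 < lam → 0 < m → 0 < δ → δ ≤ 1 →
      F.LinkAssumptions d S kμ →
      GLB.IsBandit F P ℱ T S m θ A a r →
      GLB.numChanges T θ ≤ Γ →
      GLB.IsSWGLUCB F P T τ lam S m kμ δ A a r θhat →
      ENNReal.ofReal (1 - δ) ≤ P {ω | GLB.regret F T θ A a ω ≤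
          m * Γ * τ
          + 2 * GLB.beta d T τ lam S m kμ δ T / Real.sqrt (F.cmu d S)
            * Real.sqrt (d * T) * Real.sqrt (⌈(T : ℝ) / τ⌉₊ : ℝ)
            * Real.sqrt (2 * max 1 (F.cmu d S / lam))
            * Real.sqrt (Real.log (1 + F.cmu d S * τ / (d * lam)))} ∧
      (m ≤ 1 → ENNReal.ofReal (1 - δ) ≤ P {ω | GLB.regret F T θ A a ω ≤
          Γ * τ
          + 2 * GLB.beta d T τ lam S m kμ δ T / Real.sqrt (F.cmu d S)
            * Real.sqrt (d * T) * Real.sqrt (⌈(T : ℝ) / τ⌉₊ : ℝ)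
            * Real.sqrt (2 * max 1 (1 / lam))
            * Real.sqrt (Real.log (1 + τ / (d * lam)))})) ∧
    -- the rates for the tuned window, with the number of changes known or unknown
    (∃ p : ℕ, ∀ S m kμ : ℝ, ∃ C : ℝ,
      ∀ (d T τ Γ : ℕ) (lam δ : ℝ) (F : GLB.ExpFamily)
        (Ω : Type*) (_ : MeasurableSpace Ω) (P : MeasureTheory.Measure Ω)
        (_ : MeasureTheory.IsProbabilityMeasure P)
        (ℱ : MeasureTheory.Filtration ℕ ‹MeasurableSpace Ω›)
        (θ : ℕ → GLB.Vec d) (A : ℕ → Ω → Set (GLB.Vec d)) (a : ℕ → Ω → GLB.Vec d)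
        (r : ℕ → Ω → ℝ) (θhat : ℕ → Ω → GLB.Vec d),
      1 ≤ d → 2 ≤ T → 1 ≤ τ → 1 ≤ Γ → lam = d * Real.log T → 0 < m → 0 < δ → δ ≤ 1 →
      F.LinkAssumptions d S kμ →
      GLB.IsBandit F P ℱ T S m θ A a r →
      GLB.numChanges T θ ≤ Γ →
      GLB.IsSWGLUCB F P T τ lam S m kμ δ A a r θhat →
      (|(τ : ℝ) - ((d * T : ℝ) / (F.cmu d S ^ (1 / 2 : ℝ) * Γ)) ^ (2 / 3 : ℝ)| ≤ 1 →
        ENNReal.ofReal (1 - δ) ≤ P {ω | GLB.regret F T θ A a ω ≤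
          C * Real.log (T / δ) ^ p * (F.cmu d S ^ (-(1 / 3) : ℝ) * (d : ℝ) ^ (2 / 3 : ℝ)
            * (Γ : ℝ) ^ (1 / 3 : ℝ) * (T : ℝ) ^ (2 / 3 : ℝ))}) ∧
      (|(τ : ℝ) - ((d * T : ℝ) / F.cmu d S ^ (1 / 2 : ℝ)) ^ (2 / 3 : ℝ)| ≤ 1 →
        ENNReal.ofReal (1 - δ) ≤ P {ω | GLB.regret F T θ A a ω ≤
          C * Real.log (T / δ) ^ p * (F.cmu d S ^ (-(1 / 3) : ℝ) * (d : ℝ) ^ (2 / 3 : ℝ)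
            * (Γ : ℝ) * (T : ℝ) ^ (2 / 3 : ℝ))})) := by
  refine ⟨?_, 4, fun S m kμ => ⟨GLB.tunedConst S m kμ, ?_⟩⟩
  · intro d T τ Γ lam S m kμ δ F Ω _ P _ ℱ θ A a r θhat hd hT hτ hlam hm hδ hδ1 hF hB hΓ hAlg
    exact ⟨GLB.measure_regret_le_ge hd hT hτ hlam hm hδ hδ1 hF hB hΓ hAlg, fun hm1 =>
      GLB.measure_regret_le_ge_of_le_one hd hT hτ hlam hm hm1 hδ hδ1 hF hB hΓ hAlg⟩
  · intro d T τ Γ lam δ F Ω _ P _ ℱ θ A a r θhat hd hT hτ hΓ1 hlam hm hδ hδ1 hF hB hΓ hAlg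
    subst hlam
    have hcμ := hF.cmu_pos
    have hΓ1' : (1 : ℝ) ≤ Γ := by exact_mod_cast hΓ1
    have hΓ0 : (0 : ℝ) < Γ := by linarith
    refine ⟨fun hwin => ?_, fun hwin => ?_⟩
    · have h := GLB.measure_regret_le_idealWindow_ge hd hT hτ hΓ1' le_rfl hm hδ hδ1 hF hB hΓ hAlg
        hwin
      have e : (Γ : ℝ) * GLB.idealWindow d T (F.cmu d S) Γ
          = F.cmu d S ^ (-(1 / 3) : ℝ) * (d : ℝ) ^ (2 / 3 : ℝ) * (Γ : ℝ) ^ (1 / 3 : ℝ)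
            * (T : ℝ) ^ (2 / 3 : ℝ) := by
        have hpow : (Γ : ℝ) = (Γ : ℝ) ^ (1 / 3 : ℝ) * (Γ : ℝ) ^ (2 / 3 : ℝ) := by
          rw [← Real.rpow_add hΓ0]
          norm_num
        rw [GLB.idealWindow_eq hcμ hΓ0]
        nth_rewrite 1 [hpow]
        field_simp
      rwa [e] at h
    -- Not knowing `Γ` amounts to tuning for a single change.
    · have h := GLB.measure_regret_le_idealWindow_ge (g := 1) hd hT hτ le_rfl hΓ1' hm hδ hδ1 hF hB
        hΓ hAlg (by rwa [GLB.idealWindow, mul_one])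
      have e : (Γ : ℝ) * GLB.idealWindow d T (F.cmu d S) 1
          = F.cmu d S ^ (-(1 / 3) : ℝ) * (d : ℝ) ^ (2 / 3 : ℝ) * Γ * (T : ℝ) ^ (2 / 3 : ℝ) := by
        rw [GLB.idealWindow_eq hcμ one_pos, Real.one_rpow, div_one]
        ring
      rwa [e] at h
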